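/- There is an absolute constant $C>0$ with the following property. Let $u_0,u_1:\mathbb R^3\to\mathbb R$ be smooth and radially symmetric, with $u_0\in L^\infty(\mathbb R^3)$ and $(u_0,u_1)\in\dot H^1(\mathbb R^3)\times L^2(\mathbb R^3)$, and suppose that for some $\epsilon>0$ $$(u_0)_r+|u_1|\le\frac{1-\epsilon}{r}\qquad\text{for all } r=|x|>0 .$$ Here $\dot H^1(\mathbb R^3)=\{f\in L^6(\mathbb R^3):\nabla f\in L^2(\mathbb R^3)\}$, $\|f\|_{\dot H^1}=\|\nabla f\|_{L^2}$ and $\|(f,g)\|_{\dot H^1\times L^2}=(\|f\|_{\dot H^1}^2+\|g\|_{L^2}^2)^{1/2}$. Then the equation $$u_{tt}-\Delta u=u_t^2-|\nabla u|^2,\qquad u(0)=u_0,\quad u_t(0)=u_1,$$ has a global smooth solution on $\mathbb R^3\times\mathbb R$, and every global smooth solution $u$ satisfies $u\in L^\infty_t\dot H^1_x\cap L^2_tL^\infty_x$, $u_t\in L^\infty_tL^2_x$ and $$\sup_{t\in\mathbb R}\|(u(t),u_t(t))\|_{\dot H^1\times L^2}\le e^{\sup u_0-\inf u_0}\,\epsilon^{-1}\,\|(u_0,u_1)\|_{\dot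 H^1\times L^2},$$ $$\Big(\int_{\mathbb R}\|u(t)\|_{L^\infty_x}^2\,dt\Big)^{1/2}\le C\,\max\big(1,e^{\sup u_0}\epsilon^{-1}\big)\,e^{-\inf u_0}\,\|(u_0,u_1)\|_{\dot H^1\times L^2}.$$ -/

import Mathlib

open MeasureTheory Set
open scoped ENNReal ContDiff Laplacian Gradient

noncomputable section

/-- Three-dimensional Euclidean space. -/
abbrev E3 : Type := EuclideanSpace ℝ (Fin 3)

/-- A function on space is radial if it depends only on the distance to the origin. -/
def IsRadial (f : E3 → ℝ) : Prop := ∀ x y : E3, ‖x‖ = ‖y‖ → f x = f y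

/-- The radial derivative `f_r (x) = ∇ f(x) · x / |x|`, meaningful for `x ≠ 0`. -/
def radialDeriv (f : E3 → ℝ) (x : E3) : ℝ := fderiv ℝ f x (‖x‖⁻¹ • x)

/-- The time derivative `u_t (t, x)`. -/
def timeDeriv (u : ℝ → E3 → ℝ) (t : ℝ) (x : E3) : ℝ := deriv (fun s => u s x) t

/-- `u` is a global smooth solution on `ℝ × ℝ³` of
`u_tt - Δ u = u_t ^ 2 - |∇ u| ^ 2`, `u(0) = u₀`, `u_t(0) = u₁`. -/
structure IsNullFormSolution (u : ℝ → E3 → ℝ) (u₀ u₁ : E3 → ℝ) : Prop where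
  smooth : ContDiff ℝ ∞ (fun p : ℝ × E3 => u p.1 p.2)
  equation : ∀ (t : ℝ) (x : E3),
    timeDeriv (timeDeriv u) t x - Δ (u t) x = timeDeriv u t x ^ 2 - ‖∇ (u t) x‖ ^ 2
  init : ∀ x : E3, u 0 x = u₀ x
  init_deriv : ∀ x : E3, timeDeriv u 0 x = u₁ x

/-- The homogeneous Sobolev norm `‖∇ f‖_{L²}` of a smooth function, as an extended real. -/
def hDotNorm (f : E3 → ℝ) : ℝ≥0∞ := eLpNorm (∇ f) 2 volume

/-- Membership of a smooth function in the homogeneous Sobolev space `Ḣ¹(ℝ³)`, the completion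
of the test functions under `‖∇ f‖_{L²}`: by the Sobolev embedding this is the space of
`f ∈ L⁶` with `∇ f ∈ L²`. In particular nonzero constants are excluded. -/
def MemHDot (f : E3 → ℝ) : Prop := MemLp f 6 volume ∧ MemLp (∇ f) 2 volume

/-- The norm `(‖f‖²_{Ḣ¹} + ‖g‖²_{L²})^{1/2}` of `Ḣ¹ × L²`. -/
def energyNorm (f g : E3 → ℝ) : ℝ≥0∞ :=
  (hDotNorm f ^ 2 + eLpNorm g 2 volume ^ 2) ^ (1 / 2 : ℝ)

/-- The norm of `L²_t L^∞_x`, over all times `t ∈ ℝ`. -/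
def normL2Linfty (u : ℝ → E3 → ℝ) : ℝ≥0∞ :=
  (∫⁻ t : ℝ, eLpNorm (u t) ⊤ volume ^ 2) ^ (1 / 2 : ℝ)

end

/-! The substitution $v=e^{-u}$ linearises the equation: $v_{tt}-\Delta v=e^{-u}\big(u_t^2-|\nabla
u|^2-(u_{tt}-\Delta u)\big)=0$. Radial waves in three dimensions are explicit:
$v(t,x)=\frac1{2r}\int_{t-r}^{t+r}h$ with $r=|x|$ and $h(s)=(s\,v_0)'+s\,v_1$. For $v_0=e^{-u_0}$
and $v_1=-e^{-u_0}u_1$ this is $h=e^{-u_0}(1-s\,u_0'-s\,u_1)$, and the hypothesis on the data says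
precisely that the bracket is at least $\epsilon$ (`le_waveProfile_linear`). Being a mean of $h$,
$v$ is at least $m=\epsilon e^{-\sup u_0}>0$, so $u=-\log v$ is a global smooth solution. Energy
uniqueness for the linear equation (`IsLinearWave.eq_zero`) forces every smooth solution to have
this form.

Energy bound: $|\partial_{t,x}u|=v^{-1}|\partial_{t,x}v|\le m^{-1}|\partial_{t,x}v|$; the energy of
$v$ at any time is bounded by that of its data (`IsLinearWave.energy_le`), which costs a factor
$e^{-\inf u_0}$.

Bound in $L^2_tL^\infty_x$: $|u|\le\max(1,m^{-1})|v-1|$, and $v-1$ is a mean of $h-1$ over an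
interval centred at $t$. Hence $\|v(t)-1\|_{L^\infty}$ is at most the maximal function of $h-1$ at
$t$, and the maximal theorem in $L^2$ (`lintegral_maximalFunction_sq_le`) leaves $\|h-1\|_{L^2}$.
This is controlled by the energy of the data, since $\int((sq)')^2\le\int(sq')^2$ for $q=v_0-1$
(`lintegral_waveProfile_sub_one_sq_le`). The maximal function also gives $u(t)\in L^6$. -/

open Filter Topology

/-! ### The Hardy–Littlewood maximal function on the line. -/

/-- The uncentred Hardy–Littlewood maximal function on the line. -/
noncomputable def maximalFunction (g : ℝ → ℝ≥0∞) (t : ℝ) : ℝ≥0∞ :=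
  ⨆ p : ℝ × ℝ, (Metric.ball p.1 p.2).indicator
    (fun _ => (∫⁻ s in Metric.ball p.1 p.2, g s) / ENNReal.ofReal (2 * p.2)) t

theorem lowerSemicontinuous_maximalFunction (g : ℝ → ℝ≥0∞) :
    LowerSemicontinuous (maximalFunction g) :=
  lowerSemicontinuous_iSup fun _ => Metric.isOpen_ball.lowerSemicontinuous_indicator zero_le

theorem average_le_maximalFunction (g : ℝ → ℝ≥0∞) {c r t : ℝ} (ht : t ∈ Metric.ball c r) :
    (∫⁻ s in Metric.ball c r, g s) / ENNReal.ofReal (2 * r) ≤ maximalFunction g t := by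
  refine le_trans ?_ (le_iSup _ (c, r))
  rw [indicator_of_mem ht]

theorem lt_maximalFunction_iff (g : ℝ → ℝ≥0∞) {a : ℝ≥0∞} {t : ℝ} :
    a < maximalFunction g t ↔ ∃ p : ℝ × ℝ, t ∈ Metric.ball p.1 p.2 ∧
      a < (∫⁻ s in Metric.ball p.1 p.2, g s) / ENNReal.ofReal (2 * p.2) := by
  simp only [maximalFunction, lt_iSup_iff]
  refine exists_congr fun p => ⟨fun h => ?_, fun h => by rw [indicator_of_mem h.1]; exact h.2⟩
  by_cases ht : t ∈ Metric.ball p.1 p.2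
  · exact ⟨ht, by rwa [indicator_of_mem ht] at h⟩
  · rw [indicator_of_notMem ht] at h
    exact absurd h not_lt_zero

/-- The weak type `(1,1)` bound. -/
theorem mul_volume_lt_maximalFunction_le (g : ℝ → ℝ≥0∞) {a : ℝ≥0∞} (ha0 : a ≠ 0) (ha : a ≠ ⊤) :
    a * volume {t | a < maximalFunction g t} ≤ 5 * ∫⁻ s, g s := by
  -- Finiteness of the integral bounds the radii in `T`, as Vitali's covering lemma requires.
  by_cases hA : ∫⁻ s, g s = ⊤
  · simp [hA]
  let T : Set (ℝ × ℝ) := {p | 0 < p.2 ∧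
      a < (∫⁻ s in Metric.ball p.1 p.2, g s) / ENNReal.ofReal (2 * p.2)}
  have hmul : ∀ p ∈ T, a * ENNReal.ofReal (2 * p.2) ≤ ∫⁻ s in Metric.ball p.1 p.2, g s := by
    intro p hp
    exact ENNReal.mul_le_of_le_div hp.2.le
  have hrad : ∀ p ∈ T, p.2 ≤ ((∫⁻ s, g s) / a).toReal := by
    intro p hp
    have h1 : a * ENNReal.ofReal (2 * p.2) ≤ ∫⁻ s, g s :=
      (hmul p hp).trans (setLIntegral_le_lintegral _ _)
    have h2 : ENNReal.ofReal (2 * p.2) ≤ (∫⁻ s, g s) / a := by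
      rw [ENNReal.le_div_iff_mul_le (Or.inl ha0) (Or.inl ha), mul_comm]; exact h1
    have h3 := (ENNReal.ofReal_le_iff_le_toReal (ENNReal.div_ne_top hA ha0)).1 h2
    linarith [hp.1]
  obtain ⟨U, hUT, hdisj, hcov⟩ := Vitali.exists_disjoint_subfamily_covering_enlargement_ball
    T (fun p => p.1) (fun p => p.2) _ hrad 5 (by norm_num)
  have hUc : U.Countable := by
    refine hdisj.countable_of_isOpen (fun p _ => Metric.isOpen_ball) fun p hp => ?_
    exact Metric.nonempty_ball.2 (hUT hp).1
  have hsub : {t | a < maximalFunction g t} ⊆ ⋃ p ∈ U, Metric.ball p.1 (5 * p.2) := by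
    intro t ht
    obtain ⟨p, htp, hap⟩ := (lt_maximalFunction_iff g).1 ht
    have hp : p ∈ T := ⟨Metric.pos_of_mem_ball htp, hap⟩
    obtain ⟨q, hqU, hq⟩ := hcov p hp
    exact mem_biUnion hqU (hq htp)
  calc a * volume {t | a < maximalFunction g t}
      ≤ a * ∑' p : U, volume (Metric.ball p.1.1 (5 * p.1.2)) := by
        gcongr
        exact (measure_mono hsub).trans (measure_biUnion_le _ hUc _)
    _ = ∑' p : U, 5 * (a * ENNReal.ofReal (2 * p.1.2)) := by
        rw [← ENNReal.tsum_mul_left]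
        congr 1; ext p
        rw [Real.volume_ball, show 2 * (5 * p.1.2) = 5 * (2 * p.1.2) by ring,
          ENNReal.ofReal_mul (by norm_num)]
        norm_num
        ring
    _ ≤ ∑' p : U, 5 * ∫⁻ s in Metric.ball p.1.1 p.1.2, g s := by
        gcongr with p
        exact hmul p (hUT p.2)
    _ = 5 * ∫⁻ s in ⋃ p ∈ U, Metric.ball p.1 p.2, g s := by
        rw [ENNReal.tsum_mul_left, lintegral_biUnion hUc (fun p _ => Metric.isOpen_ball.measurableSet)
          hdisj]
    _ ≤ 5 * ∫⁻ s, g s := by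
        gcongr
        exact Measure.restrict_le_self

/-- Layer-cake formula $b^2=\int_0^b 2l\,dl$, of which one inequality suffices; for $b=\infty$ the
tail over $l>1$ already diverges. -/
theorem ENNReal.sq_le_lintegral_Ioi (b : ℝ≥0∞) :
    b ^ 2 ≤ ∫⁻ l in Ioi (0 : ℝ),
      {l : ℝ | ENNReal.ofReal l < b}.indicator (fun l => 2 * ENNReal.ofReal l) l := by
  have hm : MeasurableSet {l : ℝ | ENNReal.ofReal l < b} :=
    measurableSet_lt ENNReal.measurable_ofReal measurable_const
  rw [setLIntegral_indicator hm]
  rcases eq_or_ne b ⊤ with rfl | hb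
  · have : ∫⁻ l in Ioi (1 : ℝ), (1 : ℝ≥0∞) = ⊤ := by simp
    rw [top_pow two_ne_zero]
    refine this.ge.trans ?_
    refine (setLIntegral_mono' measurableSet_Ioi fun l hl => ?_).trans
      (lintegral_mono_set fun l hl => ?_)
    · calc (1 : ℝ≥0∞) = 1 * ENNReal.ofReal 1 := by simp
        _ ≤ 2 * ENNReal.ofReal l := by
          gcongr
          · norm_num
          · exact le_of_lt hl
    · exact ⟨ENNReal.ofReal_lt_top, lt_trans one_pos (mem_Ioi.1 hl)⟩
  · lift b to NNReal using hb
    have h1 : {l : ℝ | ENNReal.ofReal l < b} ∩ Ioi 0 ⊇ Ioo 0 (b : ℝ) := by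
      intro l hl
      refine ⟨?_, hl.1⟩
      rw [mem_ofPred_eq, ENNReal.ofReal_lt_coe_iff hl.1.le]
      exact hl.2
    refine le_trans ?_ (lintegral_mono_set h1)
    have h2 : ∫⁻ l in Ioo 0 (b : ℝ), 2 * ENNReal.ofReal l
        = ENNReal.ofReal (∫ l in Ioo 0 (b : ℝ), 2 * l) := by
      rw [ofReal_integral_eq_lintegral_ofReal]
      · refine setLIntegral_congr_fun measurableSet_Ioo fun l hl => ?_
        simp [ENNReal.ofReal_mul]
      · exact ((continuous_const.mul continuous_id).integrableOn_Icc).mono_set Ioo_subset_Icc_self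
      · filter_upwards [ae_restrict_mem measurableSet_Ioo] with l hl
        have := hl.1
        simp; linarith
    rw [h2, ← integral_Ioc_eq_integral_Ioo, ← intervalIntegral.integral_of_le b.coe_nonneg,
      intervalIntegral.integral_const_mul, integral_id]
    rw [show 2 * (((b : ℝ) ^ 2 - 0 ^ 2) / 2) = (b : ℝ) ^ 2 by ring,
      ENNReal.ofReal_pow b.coe_nonneg, ENNReal.ofReal_coe_nnreal]

theorem volume_Ioi_inter_ofReal_lt_le (b : ℝ≥0∞) :
    volume ({l : ℝ | ENNReal.ofReal l < b} ∩ Ioi 0) ≤ b := by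
  rcases eq_or_ne b ⊤ with rfl | hb
  · exact le_top
  lift b to NNReal using hb
  calc volume ({l : ℝ | ENNReal.ofReal l < b} ∩ Ioi 0) ≤ volume (Ioo 0 (b : ℝ)) := by
        refine measure_mono fun l hl => ⟨hl.2, ?_⟩
        exact (ENNReal.ofReal_lt_coe_iff (le_of_lt hl.2)).1 hl.1
    _ = b := by simp

/-- Pointwise $g\le a+g\,1_{g>a}$, and averages of the constant $a$ equal $a$. The weak type bound
can then be applied to the large part of $g$ alone, as in Marcinkiewicz interpolation. -/
theorem maximalFunction_le_add (g : ℝ → ℝ≥0∞) (a : ℝ≥0∞) (t : ℝ) :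
    maximalFunction g t ≤ a + maximalFunction ({s | a < g s}.indicator g) t := by
  refine iSup_le fun p => ?_
  by_cases ht : t ∈ Metric.ball p.1 p.2
  · rw [indicator_of_mem ht]
    have hr : 0 < p.2 := Metric.pos_of_mem_ball ht
    have h0 : ENNReal.ofReal (2 * p.2) ≠ 0 := by simpa using hr
    calc (∫⁻ s in Metric.ball p.1 p.2, g s) / ENNReal.ofReal (2 * p.2)
        ≤ (∫⁻ s in Metric.ball p.1 p.2, (a + {s | a < g s}.indicator g s)) /
            ENNReal.ofReal (2 * p.2) := by
          gcongr with s
          by_cases hs : a < g s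
          · rw [indicator_of_mem (by exact hs)]; exact le_add_self
          · exact (not_lt.1 hs).trans le_self_add
      _ = a + (∫⁻ s in Metric.ball p.1 p.2, {s | a < g s}.indicator g s) /
            ENNReal.ofReal (2 * p.2) := by
          rw [lintegral_add_left measurable_const, ENNReal.add_div, setLIntegral_const,
            Real.volume_ball, ENNReal.mul_div_cancel_right h0 ENNReal.ofReal_ne_top]
      _ ≤ _ := by gcongr; exact average_le_maximalFunction _ ht
  · rw [indicator_of_notMem ht]; exact zero_le

/-- The Hardy–Littlewood maximal theorem in `L²`. -/
theorem lintegral_maximalFunction_sq_le {g : ℝ → ℝ≥0∞} (hg : Measurable g) :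
    ∫⁻ t, maximalFunction g t ^ 2 ≤ 40 * ∫⁻ s, g s ^ 2 := by
  have hM := (lowerSemicontinuous_maximalFunction g).measurable
  -- The weak bound at height $l/2$ for the part of $g$ above $l/2$; the constant is $20=4\cdot5$
  -- because $2l=4\cdot l/2$.
  have hweak : ∀ l ∈ Ioi (0 : ℝ), 2 * ENNReal.ofReal l *
      volume {t | ENNReal.ofReal l < maximalFunction g t} ≤
      20 * ∫⁻ s, {s | ENNReal.ofReal (l / 2) < g s}.indicator g s := by
    intro l hl
    have hl : 0 < l := hl
    have e1 : ENNReal.ofReal l = ENNReal.ofReal (l / 2) + ENNReal.ofReal (l / 2) := by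
      rw [← ENNReal.ofReal_add (by positivity) (by positivity)]; congr 1; ring
    have hsub : {t | ENNReal.ofReal l < maximalFunction g t} ⊆ {t | ENNReal.ofReal (l / 2) <
        maximalFunction ({s | ENNReal.ofReal (l / 2) < g s}.indicator g) t} := by
      intro t ht
      have h1 := lt_of_lt_of_le ht (maximalFunction_le_add g (ENNReal.ofReal (l / 2)) t)
      rw [e1] at h1
      exact (ENNReal.add_lt_add_iff_left ENNReal.ofReal_ne_top).1 h1
    have h2 := mul_volume_lt_maximalFunction_le
      ({s | ENNReal.ofReal (l / 2) < g s}.indicator g) (a := ENNReal.ofReal (l / 2))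
      (by simpa using hl) ENNReal.ofReal_ne_top
    calc 2 * ENNReal.ofReal l * volume {t | ENNReal.ofReal l < maximalFunction g t}
        ≤ 2 * ENNReal.ofReal l * volume {t | ENNReal.ofReal (l / 2) <
          maximalFunction ({s | ENNReal.ofReal (l / 2) < g s}.indicator g) t} := by
          gcongr
      _ = 4 * (ENNReal.ofReal (l / 2) * volume {t | ENNReal.ofReal (l / 2) <
          maximalFunction ({s | ENNReal.ofReal (l / 2) < g s}.indicator g) t}) := by
          rw [e1]; ring
      _ ≤ 4 * (5 * ∫⁻ s, {s | ENNReal.ofReal (l / 2) < g s}.indicator g s) := by gcongr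
      _ = _ := by rw [← mul_assoc]; norm_num
  have hmeas1 : Measurable (Function.uncurry fun (t l : ℝ) =>
      {l : ℝ | ENNReal.ofReal l < maximalFunction g t}.indicator
        (fun l => 2 * ENNReal.ofReal l) l) := by
    have : (Function.uncurry fun (t l : ℝ) =>
      {l : ℝ | ENNReal.ofReal l < maximalFunction g t}.indicator
        (fun l => 2 * ENNReal.ofReal l) l) =
        {q : ℝ × ℝ | ENNReal.ofReal q.2 < maximalFunction g q.1}.indicator
          (fun q => 2 * ENNReal.ofReal q.2) := by
      ext q; simp [indicator, Function.uncurry]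
    rw [this]
    exact (by fun_prop : Measurable fun q : ℝ × ℝ => 2 * ENNReal.ofReal q.2).indicator
      (measurableSet_lt (by fun_prop) (hM.comp measurable_fst))
  have hmeas2 : Measurable (Function.uncurry fun (l s : ℝ) =>
      {s | ENNReal.ofReal (l / 2) < g s}.indicator g s) := by
    have : (Function.uncurry fun (l s : ℝ) => {s | ENNReal.ofReal (l / 2) < g s}.indicator g s) =
        {q : ℝ × ℝ | ENNReal.ofReal (q.1 / 2) < g q.2}.indicator (fun q => g q.2) := by
      ext q; simp [indicator, Function.uncurry]
    rw [this]
    exact (hg.comp measurable_snd).indicator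
      (measurableSet_lt (by fun_prop) (hg.comp measurable_snd))
  calc ∫⁻ t, maximalFunction g t ^ 2
      ≤ ∫⁻ t, ∫⁻ l in Ioi (0 : ℝ), {l : ℝ | ENNReal.ofReal l < maximalFunction g t}.indicator
        (fun l => 2 * ENNReal.ofReal l) l := lintegral_mono fun t => ENNReal.sq_le_lintegral_Ioi _
    _ = ∫⁻ l in Ioi (0 : ℝ), ∫⁻ t, {l : ℝ | ENNReal.ofReal l < maximalFunction g t}.indicator
        (fun l => 2 * ENNReal.ofReal l) l := lintegral_lintegral_swap hmeas1.aemeasurable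
    _ ≤ ∫⁻ l in Ioi (0 : ℝ), 20 * ∫⁻ s, {s | ENNReal.ofReal (l / 2) < g s}.indicator g s := by
        refine setLIntegral_mono' measurableSet_Ioi fun l hl => le_trans (le_of_eq ?_) (hweak l hl)
        have : ∀ t, {l : ℝ | ENNReal.ofReal l < maximalFunction g t}.indicator
            (fun l => 2 * ENNReal.ofReal l) l = {t | ENNReal.ofReal l <
              maximalFunction g t}.indicator (fun _ => 2 * ENNReal.ofReal l) t := by
          intro t; simp [indicator]
        simp_rw [this]
        rw [lintegral_indicator_const (measurableSet_lt measurable_const hM)]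
    _ = 20 * ∫⁻ s, ∫⁻ l in Ioi (0 : ℝ), {s | ENNReal.ofReal (l / 2) < g s}.indicator g s := by
        rw [lintegral_const_mul' _ _ (by norm_num), lintegral_lintegral_swap hmeas2.aemeasurable]
    _ ≤ 20 * ∫⁻ s, 2 * g s ^ 2 := by
        gcongr with s
        -- For fixed $s$ the admissible heights are $0<l<2g(s)$, a set of length at most $2g(s)$;
        -- hence $40=20\cdot2$.
        have : ∀ l, {s | ENNReal.ofReal (l / 2) < g s}.indicator g s =
            {l : ℝ | ENNReal.ofReal l < 2 * g s}.indicator (fun _ => g s) l := by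
          intro l
          have : ENNReal.ofReal (l / 2) < g s ↔ ENNReal.ofReal l < 2 * g s := by
            rw [ENNReal.ofReal_div_of_pos two_pos, ENNReal.div_lt_iff (by simp) (by simp), mul_comm]
            simp
          simp only [indicator, mem_ofPred_eq, this]
        simp_rw [this]
        rw [lintegral_indicator_const
            (measurableSet_lt ENNReal.measurable_ofReal measurable_const),
          Measure.restrict_apply (measurableSet_lt ENNReal.measurable_ofReal measurable_const)]
        calc _ ≤ g s * (2 * g s) := by gcongr; exact volume_Ioi_inter_ofReal_lt_le _
          _ = _ := by ring
    _ = 40 * ∫⁻ s, g s ^ 2 := by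
        rw [lintegral_const_mul' _ _ (by norm_num), ← mul_assoc]; norm_num

/-! ### Space-time derivatives and linear waves. -/

/-- The derivative of `W` in the constant direction `v` of space-time. -/
noncomputable def dirDeriv (v : ℝ × E3) (W : ℝ × E3 → ℝ) (p : ℝ × E3) : ℝ := fderiv ℝ W p v

/-- The time direction. -/
noncomputable def timeDir : ℝ × E3 := (1, 0)

/-- The coordinate directions in space. -/
noncomputable def spaceDir (i : Fin 3) : ℝ × E3 := (0, EuclideanSpace.basisFun (Fin 3) ℝ i)

/-- Smooth solutions of the linear wave equation on `ℝ × ℝ³`. -/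
structure IsLinearWave (W : ℝ × E3 → ℝ) : Prop where
  smooth : ContDiff ℝ ∞ W
  equation : ∀ p, dirDeriv timeDir (dirDeriv timeDir W) p =
    ∑ i, dirDeriv (spaceDir i) (dirDeriv (spaceDir i) W) p

/-- The energy density. -/
noncomputable def energyDensity (W : ℝ × E3 → ℝ) (p : ℝ × E3) : ℝ :=
  dirDeriv timeDir W p ^ 2 + ∑ i, dirDeriv (spaceDir i) W p ^ 2

theorem ContDiff.dirDeriv {W : ℝ × E3 → ℝ} (hW : ContDiff ℝ ∞ W) (v : ℝ × E3) :
    ContDiff ℝ ∞ (dirDeriv v W) :=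
  (hW.fderiv_right (m := ∞) (by simp)).clm_apply contDiff_const

theorem dirDeriv_comm {W : ℝ × E3 → ℝ} (hW : ContDiff ℝ ∞ W) (v w p : ℝ × E3) :
    dirDeriv v (dirDeriv w W) p = dirDeriv w (dirDeriv v W) p := by
  have hd : DifferentiableAt ℝ (fderiv ℝ W) p :=
    (hW.fderiv_right (m := ∞) (by simp)).differentiable (by simp) p
  have key : ∀ a b : ℝ × E3, dirDeriv a (dirDeriv b W) p = fderiv ℝ (fderiv ℝ W) p a b := by
    intro a b
    have := (hd.hasFDerivAt.clm_apply (hasFDerivAt_const b p)).fderiv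
    show fderiv ℝ (fun q => fderiv ℝ W q b) p a = _
    rw [this]; simp
  rw [key, key]
  have hs : IsSymmSndFDerivAt ℝ W p := hW.contDiffAt.isSymmSndFDerivAt (by
    rw [minSmoothness_of_isRCLikeNormedField]
    exact WithTop.coe_le_coe.2 (le_top : (2 : ℕ∞) ≤ ⊤))
  exact hs v w

theorem integral_fderiv_eq_zero_of_hasCompactSupport {f : E3 → ℝ} (hf : ContDiff ℝ 1 f)
    (hc : HasCompactSupport f) (v : E3) : ∫ x, fderiv ℝ f x v = 0 := by
  have h1 : Continuous fun x => fderiv ℝ f x v :=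
    (hf.continuous_fderiv (by simp)).clm_apply continuous_const
  have h2 : HasCompactSupport fun x => fderiv ℝ f x v := hc.fderiv_apply ℝ v
  have := integral_mul_fderiv_eq_neg_fderiv_mul_of_integrable (μ := (volume : Measure E3))
    (f := fun _ => (1 : ℝ)) (g := f) (v := v) (by simp)
    (by simpa using h1.integrable_of_hasCompactSupport h2)
    (by simpa using hf.continuous.integrable_of_hasCompactSupport hc)
    (fun x _ => differentiableAt_const _) (fun x _ => hf.differentiable (by simp) x)
  simpa using this

theorem dirDeriv_space_eq {P : ℝ × E3 → ℝ} (hP : Differentiable ℝ P) (t : ℝ) (x v : E3) :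
    fderiv ℝ (fun x => P (t, x)) x v = dirDeriv (0, v) P (t, x) := by
  have h := (hP (t, x)).hasFDerivAt.comp x (hasFDerivAt_prodMk_right t x)
  have h' : HasFDerivAt (fun x => P (t, x)) _ x := h
  rw [h'.fderiv]; simp [dirDeriv]

theorem hasDerivAt_time {P : ℝ × E3 → ℝ} (hP : Differentiable ℝ P) (t : ℝ) (x : E3) :
    HasDerivAt (fun t => P (t, x)) (dirDeriv timeDir P (t, x)) t := by
  have h := (hP (t, x)).hasFDerivAt.comp_hasDerivAt t
    ((hasDerivAt_id t).prodMk (hasDerivAt_const t x))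
  exact h

/-! ### The divergence theorem on time slabs. -/

section Divergence

variable {P : ℝ × E3 → ℝ} {R : ℝ}

theorem hasCompactSupport_slice (hR : ∀ t x, 0 ≤ t → R ≤ ‖x‖ → P (t, x) = 0) {t : ℝ}
    (ht : 0 ≤ t) : HasCompactSupport fun x => P (t, x) := by
  refine HasCompactSupport.of_support_subset_isCompact (isCompact_closedBall (0 : E3) R) ?_
  intro x hx
  rw [mem_closedBall_zero_iff]
  by_contra! h
  exact hx (hR t x ht h.le)

theorem integral_dirDeriv_space_eq_zero (hP : ContDiff ℝ ∞ P)
    (hR : ∀ t x, 0 ≤ t → R ≤ ‖x‖ → P (t, x) = 0) {t : ℝ} (ht : 0 ≤ t) (i : Fin 3) :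
    ∫ x, dirDeriv (spaceDir i) P (t, x) = 0 := by
  have h1 : ContDiff ℝ 1 fun x => P (t, x) :=
    (hP.of_le (by exact_mod_cast le_top)).comp (contDiff_const.prodMk contDiff_id)
  rw [← integral_fderiv_eq_zero_of_hasCompactSupport h1 (hasCompactSupport_slice hR ht)
    (EuclideanSpace.basisFun (Fin 3) ℝ i)]
  congr 1; ext x
  rw [dirDeriv_space_eq (hP.differentiable (by simp))]; rfl

theorem integrableOn_slab (hP : Continuous P)
    (hR : ∀ t x, 0 ≤ t → R ≤ ‖x‖ → P (t, x) = 0) (T : ℝ) :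
    Integrable P ((volume.restrict (Ioc 0 T)).prod (volume : Measure E3)) := by
  have h1 : IntegrableOn P (Icc 0 T ×ˢ Metric.closedBall (0 : E3) R)
      (volume.prod (volume : Measure E3)) :=
    hP.continuousOn.integrableOn_compact (isCompact_Icc.prod (isCompact_closedBall _ _))
  have h2 : IntegrableOn P (Icc 0 T ×ˢ univ) (volume.prod (volume : Measure E3)) := by
    refine h1.of_forall_sdiff_eq_zero (measurableSet_Icc.prod MeasurableSet.univ) ?_
    rintro ⟨t, x⟩ ⟨h, h'⟩
    refine hR t x h.1.1 ?_
    by_contra! hx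
    exact h' ⟨h.1, by rw [mem_closedBall_zero_iff]; exact hx.le⟩
  have h3 := h2.mono_set (prod_mono_left (t := (univ : Set E3)) (Ioc_subset_Icc_self (a := (0 : ℝ)) (b := T)))
  rw [IntegrableOn, ← Measure.prod_restrict, Measure.restrict_univ] at h3
  exact h3

theorem integrable_slice (hP : Continuous P)
    (hR : ∀ t x, 0 ≤ t → R ≤ ‖x‖ → P (t, x) = 0) {t : ℝ} (ht : 0 ≤ t) :
    Integrable fun x => P (t, x) :=
  (hP.comp (by fun_prop)).integrable_of_hasCompactSupport (hasCompactSupport_slice hR ht)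

theorem integral_slice_sub (hP : ContDiff ℝ ∞ P)
    (hR : ∀ t x, 0 ≤ t → R ≤ ‖x‖ → P (t, x) = 0)
    (hR' : ∀ t x, 0 ≤ t → R ≤ ‖x‖ → dirDeriv timeDir P (t, x) = 0) {T : ℝ} (hT : 0 ≤ T) :
    (∫ x, P (T, x)) - ∫ x, P (0, x) = ∫ t in Ioc 0 T, ∫ x, dirDeriv timeDir P (t, x) := by
  have hc := (hP.dirDeriv timeDir).continuous
  rw [integral_integral_swap (f := fun t x => dirDeriv timeDir P (t, x))
      (integrableOn_slab hc hR' T),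
    ← integral_sub (integrable_slice hP.continuous hR hT)
      (integrable_slice hP.continuous hR le_rfl)]
  congr 1; ext x
  rw [← intervalIntegral.integral_of_le hT,
    intervalIntegral.integral_eq_sub_of_hasDerivAt
      (fun t _ => hasDerivAt_time (hP.differentiable (by simp)) t x)]
  exact (hc.comp (by fun_prop : Continuous fun t : ℝ => (t, x))).intervalIntegrable _ _

/-- If a space-time vector field of spatially compact support has nonpositive divergence, the
integral of its time component decreases. -/
theorem integral_slice_le_of_divergence_nonpos {Q : Fin 3 → ℝ × E3 → ℝ} (hP : ContDiff ℝ ∞ P)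
    (hR : ∀ t x, 0 ≤ t → R ≤ ‖x‖ → P (t, x) = 0)
    (hR' : ∀ t x, 0 ≤ t → R ≤ ‖x‖ → dirDeriv timeDir P (t, x) = 0)
    (hQ : ∀ i, ContDiff ℝ ∞ (Q i))
    (hQR : ∀ i t x, 0 ≤ t → R ≤ ‖x‖ → Q i (t, x) = 0)
    (hQR' : ∀ i t x, 0 ≤ t → R ≤ ‖x‖ → dirDeriv (spaceDir i) (Q i) (t, x) = 0)
    (hdiv : ∀ p, dirDeriv timeDir P p + ∑ i, dirDeriv (spaceDir i) (Q i) p ≤ 0)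
    {T : ℝ} (hT : 0 ≤ T) :
    ∫ x, P (T, x) ≤ ∫ x, P (0, x) := by
  rw [← sub_nonpos, integral_slice_sub hP hR hR' hT]
  refine setIntegral_nonpos measurableSet_Ioc fun t ht => ?_
  have h0 : 0 ≤ t := ht.1.le
  have h1 : ∫ x, ∑ i, dirDeriv (spaceDir i) (Q i) (t, x) = 0 := by
    rw [integral_finsetSum _ fun i _ =>
      integrable_slice ((hQ i).dirDeriv _).continuous (hQR' i) h0]
    exact Finset.sum_eq_zero fun i _ => integral_dirDeriv_space_eq_zero (hQ i) (hQR i) h0 i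
  have h2 := integral_add (integrable_slice (hP.dirDeriv _).continuous hR' h0)
    (integrable_finsetSum Finset.univ fun i _ =>
      integrable_slice ((hQ i).dirDeriv (spaceDir i)).continuous (hQR' i) h0)
  rw [h1, add_zero] at h2
  rw [← h2]
  exact integral_nonpos fun x => hdiv (t, x)

end Divergence

/-! ### The cone cutoff and the calculus of directional derivatives. -/

/-- A smooth cutoff to the backward cone of height `R`. -/
noncomputable def coneCutoff (R : ℝ) (p : ℝ × E3) : ℝ :=
  Real.smoothTransition (R - p.1 - √(1 + ‖p.2‖ ^ 2))

theorem norm_le_sqrt_one_add_sq (x : E3) : ‖x‖ < √(1 + ‖x‖ ^ 2) :=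
  Real.lt_sqrt_of_sq_lt (by linarith)

theorem contDiff_coneCutoff (R : ℝ) : ContDiff ℝ ∞ (coneCutoff R) := by
  refine Real.smoothTransition.contDiff.comp ?_
  refine (contDiff_const.sub contDiff_fst).sub (ContDiff.sqrt ?_ fun p => by positivity)
  exact contDiff_const.add (contDiff_snd.norm_sq ℝ)

/-- Since $\sqrt{1+|x|^2}>|x|$ strictly, the argument of the cutoff is negative near $(t,x)$, so the
derivatives vanish there as well. The square root also keeps the cutoff smooth at $x=0$. -/
theorem coneCutoff_eventuallyEq_zero {R t : ℝ} {x : E3} (ht : 0 ≤ t) (hx : R ≤ ‖x‖) :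
    coneCutoff R =ᶠ[𝓝 (t, x)] 0 := by
  have h : Continuous fun p : ℝ × E3 => R - p.1 - √(1 + ‖p.2‖ ^ 2) := by fun_prop
  have h0 : R - t - √(1 + ‖x‖ ^ 2) < 0 := by linarith [norm_le_sqrt_one_add_sq x]
  filter_upwards [h.continuousAt.eventually_lt (continuousAt_const (y := (0 : ℝ))) h0] with p hp
  exact Real.smoothTransition.zero_of_nonpos hp.le

/-- The derivatives of the cutoff; the slope is nonnegative and the direction subluminal. -/
theorem exists_dirDeriv_coneCutoff (R : ℝ) (p : ℝ × E3) : ∃ (m : ℝ) (d : Fin 3 → ℝ),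
    0 ≤ m ∧ ∑ i, d i ^ 2 ≤ 1 ∧ dirDeriv timeDir (coneCutoff R) p = -m ∧
      ∀ i, dirDeriv (spaceDir i) (coneCutoff R) p = -(m * d i) := by
  have hq : (0 : ℝ) < 1 + ‖p.2‖ ^ 2 := by positivity
  have h1 : HasFDerivAt (fun p : ℝ × E3 => R - p.1 - √(1 + ‖p.2‖ ^ 2)) _ p :=
    ((hasFDerivAt_fst (𝕜 := ℝ) (p := p)).const_sub R).sub
      ((((hasFDerivAt_snd (𝕜 := ℝ) (p := p)).norm_sq).const_add 1).sqrt hq.ne')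
  have hη : DifferentiableAt ℝ Real.smoothTransition (R - p.1 - √(1 + ‖p.2‖ ^ 2)) :=
    (Real.smoothTransition.contDiff (n := 1)).differentiable (by simp) _
  have h2 := hη.hasDerivAt.comp_hasFDerivAt p h1
  have h3 : fderiv ℝ (coneCutoff R) p = _ := h2.fderiv
  refine ⟨deriv Real.smoothTransition (R - p.1 - √(1 + ‖p.2‖ ^ 2)),
    fun i => p.2 i / √(1 + ‖p.2‖ ^ 2), ?_, ?_, ?_, ?_⟩
  · exact Real.smoothTransition.monotone.deriv_nonneg
  · simp_rw [div_pow]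
    rw [← Finset.sum_div, Real.sq_sqrt hq.le, div_le_one hq]
    have := EuclideanSpace.real_norm_sq_eq p.2
    linarith
  · rw [dirDeriv, h3]
    simp [timeDir]
  · intro i
    rw [dirDeriv, h3]
    simp [spaceDir, EuclideanSpace.inner_single_right]
    left
    ring

theorem dirDeriv_mul {f g : ℝ × E3 → ℝ} (hf : ContDiff ℝ ∞ f) (hg : ContDiff ℝ ∞ g)
    (v p : ℝ × E3) : dirDeriv v (fun p => f p * g p) p =
      dirDeriv v f p * g p + f p * dirDeriv v g p := by
  rw [dirDeriv, fderiv_fun_mul (hf.differentiable (by simp) p) (hg.differentiable (by simp) p)]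
  simp [dirDeriv]; ring

theorem dirDeriv_add {f g : ℝ × E3 → ℝ} (hf : ContDiff ℝ ∞ f) (hg : ContDiff ℝ ∞ g)
    (v p : ℝ × E3) : dirDeriv v (fun p => f p + g p) p = dirDeriv v f p + dirDeriv v g p := by
  rw [dirDeriv, fderiv_fun_add (hf.differentiable (by simp) p) (hg.differentiable (by simp) p)]
  simp [dirDeriv]

theorem dirDeriv_sub {f g : ℝ × E3 → ℝ} (hf : ContDiff ℝ ∞ f) (hg : ContDiff ℝ ∞ g)
    (v p : ℝ × E3) : dirDeriv v (fun p => f p - g p) p = dirDeriv v f p - dirDeriv v g p := by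
  rw [dirDeriv, fderiv_fun_sub (hf.differentiable (by simp) p) (hg.differentiable (by simp) p)]
  simp [dirDeriv]

theorem dirDeriv_sum {ι : Type*} {s : Finset ι} {f : ι → ℝ × E3 → ℝ}
    (hf : ∀ i, ContDiff ℝ ∞ (f i)) (v p : ℝ × E3) :
    dirDeriv v (fun p => ∑ i ∈ s, f i p) p = ∑ i ∈ s, dirDeriv v (f i) p := by
  rw [dirDeriv, fderiv_fun_sum fun j _ => (hf j).differentiable (by simp) p]
  simp [dirDeriv]

theorem dirDeriv_neg_dir (v : ℝ × E3) (f : ℝ × E3 → ℝ) :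
    dirDeriv (-v) f = fun p => -dirDeriv v f p := by
  ext p; simp [dirDeriv]

theorem dirDeriv_neg (v : ℝ × E3) (f : ℝ × E3 → ℝ) :
    dirDeriv v (fun p => -f p) = fun p => -dirDeriv v f p := by
  ext p; simp [dirDeriv]

/-! ### Energy inequality and uniqueness for the linear wave equation. -/

namespace IsLinearWave

variable {W : ℝ × E3 → ℝ}

theorem contDiff_energyDensity (hW : ContDiff ℝ ∞ W) : ContDiff ℝ ∞ (energyDensity W) :=
  ((hW.dirDeriv _).pow 2).add (ContDiff.sum fun _ _ => (hW.dirDeriv _).pow 2)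

/-- The current $(W_t^2+|\nabla W|^2,\,-2W_t\nabla W)$ is divergence free, so only derivatives of
the weight `c` survive. -/
theorem divergence_eq (hW : IsLinearWave W) {c : ℝ × E3 → ℝ} (hc : ContDiff ℝ ∞ c) (p : ℝ × E3) :
    dirDeriv timeDir (fun p => c p * energyDensity W p) p +
      ∑ i, dirDeriv (spaceDir i)
        (fun p => c p * (-2 * (dirDeriv timeDir W p * dirDeriv (spaceDir i) W p))) p =
    dirDeriv timeDir c p * energyDensity W p -
      2 * dirDeriv timeDir W p * ∑ i, dirDeriv (spaceDir i) c p * dirDeriv (spaceDir i) W p := by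
  have hd : ∀ v, ContDiff ℝ ∞ (dirDeriv v W) := fun v => hW.smooth.dirDeriv v
  have he : dirDeriv timeDir (energyDensity W) p =
      2 * dirDeriv timeDir W p * dirDeriv timeDir (dirDeriv timeDir W) p +
      ∑ i, 2 * dirDeriv (spaceDir i) W p * dirDeriv (spaceDir i) (dirDeriv timeDir W) p := by
    have : energyDensity W = fun p => dirDeriv timeDir W p * dirDeriv timeDir W p +
        ∑ i, dirDeriv (spaceDir i) W p * dirDeriv (spaceDir i) W p := by
      ext p; simp [energyDensity, sq]
    rw [this, dirDeriv_add ((hd _).mul (hd _)) (ContDiff.sum fun _ _ => (hd _).mul (hd _)),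
      dirDeriv_mul (hd _) (hd _), dirDeriv_sum fun _ => (hd _).mul (hd _)]
    congr 1
    · ring
    · refine Finset.sum_congr rfl fun i _ => ?_
      rw [dirDeriv_mul (hd _) (hd _), dirDeriv_comm hW.smooth timeDir]
      ring
  have hf : ∀ i, dirDeriv (spaceDir i)
        (fun p => c p * (-2 * (dirDeriv timeDir W p * dirDeriv (spaceDir i) W p))) p =
      dirDeriv (spaceDir i) c p * (-2 * (dirDeriv timeDir W p * dirDeriv (spaceDir i) W p)) +
      c p * (-2 * (dirDeriv (spaceDir i) (dirDeriv timeDir W) p * dirDeriv (spaceDir i) W p +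
        dirDeriv timeDir W p * dirDeriv (spaceDir i) (dirDeriv (spaceDir i) W) p)) := by
    intro i
    rw [dirDeriv_mul hc (contDiff_const.mul ((hd _).mul (hd _))),
      dirDeriv_mul contDiff_const ((hd _).mul (hd _)), dirDeriv_mul (hd _) (hd _)]
    simp [dirDeriv]
  rw [dirDeriv_mul hc (contDiff_energyDensity hW.smooth), he, hW.equation]
  simp_rw [hf, Fin.sum_univ_three]
  ring

/-- Completing the square in `c i - a * d i` leaves $a^2(1-|d|^2)\ge0$: no energy enters through the
sides of a cone with subluminal slope. -/
theorem cutoff_flux_nonpos (a m : ℝ) (d c : Fin 3 → ℝ) (hm : 0 ≤ m) (hd : ∑ i, d i ^ 2 ≤ 1) :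
    -m * (a ^ 2 + ∑ i, c i ^ 2) - 2 * a * ∑ i, -(m * d i) * c i ≤ 0 := by
  have h1 : -m * (a ^ 2 + ∑ i, c i ^ 2) - 2 * a * ∑ i, -(m * d i) * c i =
      -m * ((∑ i, (c i - a * d i) ^ 2) + a ^ 2 * (1 - ∑ i, d i ^ 2)) := by
    simp_rw [Fin.sum_univ_three]; ring
  rw [h1, neg_mul, neg_nonpos]
  have : 0 ≤ 1 - ∑ i, d i ^ 2 := by linarith
  positivity

theorem localEnergy_le (hW : IsLinearWave W) (R : ℝ) {T : ℝ} (hT : 0 ≤ T) :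
    ∫ x, coneCutoff R (T, x) * energyDensity W (T, x) ≤
      ∫ x, coneCutoff R (0, x) * energyDensity W (0, x) := by
  have hc := contDiff_coneCutoff R
  have he := contDiff_energyDensity hW.smooth
  have hd : ∀ v, ContDiff ℝ ∞ (dirDeriv v W) := fun v => hW.smooth.dirDeriv v
  have hz : ∀ (f : ℝ × E3 → ℝ) (t : ℝ) (x : E3), 0 ≤ t → R ≤ ‖x‖ →
      (fun p => coneCutoff R p * f p) =ᶠ[𝓝 (t, x)] 0 := by
    intro f t x ht hx
    filter_upwards [coneCutoff_eventuallyEq_zero ht hx] with p hp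
    simp [hp]
  have hz' : ∀ (f : ℝ × E3 → ℝ) (v : ℝ × E3) (t : ℝ) (x : E3), 0 ≤ t → R ≤ ‖x‖ →
      dirDeriv v (fun p => coneCutoff R p * f p) (t, x) = 0 := by
    intro f v t x ht hx
    rw [dirDeriv, (hz f t x ht hx).fderiv_eq]; simp
  refine integral_slice_le_of_divergence_nonpos
    (P := fun p => coneCutoff R p * energyDensity W p) (R := R)
    (Q := fun i p => coneCutoff R p * (-2 * (dirDeriv timeDir W p * dirDeriv (spaceDir i) W p)))
    (hc.mul he) (fun t x ht hx => (hz _ t x ht hx).eq_of_nhds) (hz' _ _)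
    (fun i => hc.mul (contDiff_const.mul ((hd _).mul (hd _))))
    (fun i t x ht hx => (hz (fun p => -2 * (dirDeriv timeDir W p * dirDeriv (spaceDir i) W p))
      t x ht hx).eq_of_nhds) (fun i => hz' _ _) (fun p => ?_) hT
  rw [hW.divergence_eq hc]
  obtain ⟨m, d, hm, hd, h0, h1⟩ := exists_dirDeriv_coneCutoff R p
  rw [h0]
  simp_rw [h1]
  exact cutoff_flux_nonpos _ m d _ hm hd

theorem energyDensity_nonneg (W : ℝ × E3 → ℝ) (p : ℝ × E3) : 0 ≤ energyDensity W p := by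
  unfold energyDensity; positivity

/-- The local inequality is uniform in the height of the cone; the heights tend to infinity and
Fatou's lemma applies, so finite energy need not be assumed. -/
theorem energy_le_of_nonneg (hW : IsLinearWave W) {T : ℝ} (hT : 0 ≤ T) :
    ∫⁻ x, ENNReal.ofReal (energyDensity W (T, x)) ≤
      ∫⁻ x, ENNReal.ofReal (energyDensity W (0, x)) := by
  have he := (contDiff_energyDensity hW.smooth).continuous
  have hint : ∀ (R t : ℝ), 0 ≤ t →
      Integrable fun x => coneCutoff R (t, x) * energyDensity W (t, x) := by
    intro R t ht
    refine integrable_slice (P := fun p => coneCutoff R p * energyDensity W p) (R := R)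
      ((contDiff_coneCutoff R).continuous.mul he) (fun t x ht hx => ?_) ht
    simp [(coneCutoff_eventuallyEq_zero ht hx).eq_of_nhds]
  have hnn : ∀ R p, 0 ≤ coneCutoff R p * energyDensity W p := fun R p =>
    mul_nonneg (Real.smoothTransition.nonneg _) (energyDensity_nonneg W p)
  have hR : ∀ R : ℝ, ∫⁻ x, ENNReal.ofReal (coneCutoff R (T, x) * energyDensity W (T, x)) ≤
      ∫⁻ x, ENNReal.ofReal (energyDensity W (0, x)) := by
    intro R
    rw [← ofReal_integral_eq_lintegral_ofReal (hint R T hT) (ae_of_all _ fun x => hnn R _)]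
    refine (ENNReal.ofReal_le_ofReal (hW.localEnergy_le R hT)).trans ?_
    rw [ofReal_integral_eq_lintegral_ofReal (hint R 0 le_rfl) (ae_of_all _ fun x => hnn R _)]
    refine lintegral_mono fun x => ENNReal.ofReal_le_ofReal ?_
    exact mul_le_of_le_one_left (energyDensity_nonneg W _) (Real.smoothTransition.le_one _)
  have hlim : ∀ x, Tendsto (fun n : ℕ =>
      ENNReal.ofReal (coneCutoff n (T, x) * energyDensity W (T, x))) atTop
      (𝓝 (ENNReal.ofReal (energyDensity W (T, x)))) := by
    intro x
    refine tendsto_const_nhds.congr' ?_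
    obtain ⟨N, hN⟩ := exists_nat_ge (1 + T + √(1 + ‖x‖ ^ 2))
    filter_upwards [eventually_ge_atTop N] with n hn
    have : (N : ℝ) ≤ n := by exact_mod_cast hn
    rw [coneCutoff, Real.smoothTransition.one_of_one_le (by simp only; linarith), one_mul]
  calc ∫⁻ x, ENNReal.ofReal (energyDensity W (T, x))
      = ∫⁻ x, liminf (fun n : ℕ =>
          ENNReal.ofReal (coneCutoff n (T, x) * energyDensity W (T, x))) atTop := by
        simp_rw [fun x => (hlim x).liminf_eq]
    _ ≤ liminf (fun n : ℕ => ∫⁻ x,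
          ENNReal.ofReal (coneCutoff n (T, x) * energyDensity W (T, x))) atTop := by
        refine lintegral_liminf_le fun n => ENNReal.measurable_ofReal.comp ?_
        exact (((contDiff_coneCutoff n).continuous.mul he).comp
          (by fun_prop : Continuous fun x : E3 => (T, x))).measurable
    _ ≤ _ := by
        refine liminf_le_of_le (by isBoundedDefault) fun b hb => ?_
        obtain ⟨n, hn⟩ := hb.exists
        exact hn.trans (hR n)

theorem dirDeriv_comp {L : ℝ × E3 →L[ℝ] ℝ × E3} {f : ℝ × E3 → ℝ} (hf : ContDiff ℝ ∞ f)
    (v : ℝ × E3) : dirDeriv v (fun p => f (L p)) = fun p => dirDeriv (L v) f (L p) := by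
  ext p
  have h := (hf.differentiable (by simp) (L p)).hasFDerivAt.comp p L.hasFDerivAt
  have h' : HasFDerivAt (fun p => f (L p)) _ p := h
  rw [dirDeriv, h'.fderiv]; rfl

/-- Reflection in time. -/
noncomputable def timeReflection : ℝ × E3 →L[ℝ] ℝ × E3 :=
  (-ContinuousLinearMap.fst ℝ ℝ E3).prod (ContinuousLinearMap.snd ℝ ℝ E3)

theorem timeReflection_apply (t : ℝ) (x : E3) : timeReflection (t, x) = (-t, x) := rfl

theorem timeReflection_timeDir : timeReflection timeDir = -timeDir := by
  simp [timeReflection, timeDir]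

theorem timeReflection_spaceDir (i : Fin 3) : timeReflection (spaceDir i) = spaceDir i := by
  simp [timeReflection, spaceDir]

theorem timeReverse (hW : IsLinearWave W) : IsLinearWave fun p => W (timeReflection p) where
  smooth := hW.smooth.comp timeReflection.contDiff
  equation p := by
    have h1 := fun v => dirDeriv_comp (L := timeReflection) hW.smooth v
    have h2 := fun v w => dirDeriv_comp (L := timeReflection) (hW.smooth.dirDeriv w) v
    simp_rw [h1, h2, timeReflection_timeDir, timeReflection_spaceDir, ← hW.equation,
      dirDeriv_neg_dir, dirDeriv_neg, neg_neg]

theorem energyDensity_timeReverse (hW : ContDiff ℝ ∞ W) (p : ℝ × E3) :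
    energyDensity (fun p => W (timeReflection p)) p = energyDensity W (timeReflection p) := by
  simp_rw [energyDensity, fun v => dirDeriv_comp (L := timeReflection) hW v,
    timeReflection_timeDir, timeReflection_spaceDir, dirDeriv_neg_dir, neg_sq]

/-- The energy inequality, forwards and backwards in time. -/
theorem energy_le (hW : IsLinearWave W) (T : ℝ) :
    ∫⁻ x, ENNReal.ofReal (energyDensity W (T, x)) ≤
      ∫⁻ x, ENNReal.ofReal (energyDensity W (0, x)) := by
  rcases le_total 0 T with hT | hT
  · exact hW.energy_le_of_nonneg hT
  · have := hW.timeReverse.energy_le_of_nonneg (neg_nonneg.2 hT)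
    simpa [energyDensity_timeReverse hW.smooth, timeReflection_apply] using this

theorem sub {V : ℝ × E3 → ℝ} (hW : IsLinearWave W) (hV : IsLinearWave V) :
    IsLinearWave fun p => W p - V p where
  smooth := hW.smooth.sub hV.smooth
  equation p := by
    have h1 : ∀ v, dirDeriv v (fun p => W p - V p) = fun p => dirDeriv v W p - dirDeriv v V p :=
      fun v => funext fun p => dirDeriv_sub hW.smooth hV.smooth v p
    simp_rw [h1, dirDeriv_sub (hW.smooth.dirDeriv _) (hV.smooth.dirDeriv _), hW.equation,
      hV.equation, Finset.sum_sub_distrib]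

/-- Vanishing data have zero energy, hence the density vanishes almost everywhere on every slice,
and everywhere by continuity. Then $W_t=0$ and $W$ keeps its initial value $0$. -/
theorem eq_zero (hW : IsLinearWave W) (h0 : ∀ x, W (0, x) = 0)
    (h1 : ∀ x, dirDeriv timeDir W (0, x) = 0) (p : ℝ × E3) : W p = 0 := by
  have hdiff := hW.smooth.differentiable (by simp)
  have hE0 : ∀ x, energyDensity W (0, x) = 0 := by
    intro x
    have : ∀ i, dirDeriv (spaceDir i) W (0, x) = 0 := by
      intro i
      have := dirDeriv_space_eq hdiff 0 x (EuclideanSpace.basisFun (Fin 3) ℝ i)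
      rw [show spaceDir i = (0, EuclideanSpace.basisFun (Fin 3) ℝ i) from rfl, ← this]
      simp [h0]
    simp [energyDensity, h1, this]
  have hE : ∀ t x, energyDensity W (t, x) = 0 := by
    intro t
    have hc : Continuous fun x => energyDensity W (t, x) :=
      (contDiff_energyDensity hW.smooth).continuous.comp (by fun_prop)
    have h2 : ∫⁻ x, ENNReal.ofReal (energyDensity W (t, x)) = 0 :=
      le_antisymm ((hW.energy_le t).trans (by simp [hE0])) zero_le
    rw [lintegral_eq_zero_iff hc.measurable.ennreal_ofReal] at h2
    have h3 : (fun x => energyDensity W (t, x)) =ᵐ[volume] fun _ => 0 := by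
      filter_upwards [h2] with x hx
      exact le_antisymm (ENNReal.ofReal_eq_zero.1 hx) (energyDensity_nonneg W _)
    exact congrFun ((hc.ae_eq_iff_eq volume continuous_const).1 h3)
  have hd : ∀ t x, dirDeriv timeDir W (t, x) = 0 := by
    intro t x
    have h := hE t x
    have hs : 0 ≤ ∑ i, dirDeriv (spaceDir i) W (t, x) ^ 2 := by positivity
    have : dirDeriv timeDir W (t, x) ^ 2 = 0 := by
      unfold energyDensity at h
      nlinarith [sq_nonneg (dirDeriv timeDir W (t, x))]
    exact pow_eq_zero_iff (two_ne_zero) |>.1 this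
  have := is_const_of_deriv_eq_zero (f := fun t => W (t, p.2))
    (fun t => (hasDerivAt_time hdiff t p.2).differentiableAt)
    (fun t => by rw [(hasDerivAt_time hdiff t p.2).deriv, hd]) p.1 0
  simpa [h0] using this

end IsLinearWave

/-! ### The exponential substitution relating the nonlinear and the linear equation. -/

section Bridge

variable {u : ℝ → E3 → ℝ}

theorem timeDeriv_eq (hu : ContDiff ℝ ∞ fun p : ℝ × E3 => u p.1 p.2) :
    timeDeriv u = fun t x => dirDeriv timeDir (fun p => u p.1 p.2) (t, x) := by
  ext t x
  exact (hasDerivAt_time (hu.differentiable (by simp)) t x).deriv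

theorem timeDeriv_timeDeriv_eq (hu : ContDiff ℝ ∞ fun p : ℝ × E3 => u p.1 p.2) (t : ℝ) (x : E3) :
    timeDeriv (timeDeriv u) t x =
      dirDeriv timeDir (dirDeriv timeDir fun p => u p.1 p.2) (t, x) := by
  rw [timeDeriv_eq hu]
  exact (hasDerivAt_time ((hu.dirDeriv timeDir).differentiable (by simp)) t x).deriv

theorem fderiv_slice_eq (hu : ContDiff ℝ ∞ fun p : ℝ × E3 => u p.1 p.2) (t : ℝ) (x : E3)
    (i : Fin 3) : fderiv ℝ (u t) x (EuclideanSpace.basisFun (Fin 3) ℝ i) =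
      dirDeriv (spaceDir i) (fun p => u p.1 p.2) (t, x) :=
  dirDeriv_space_eq (hu.differentiable (by simp)) t x _

theorem laplacian_slice_eq (hu : ContDiff ℝ ∞ fun p : ℝ × E3 => u p.1 p.2) (t : ℝ) (x : E3) :
    Δ (u t) x =
      ∑ i, dirDeriv (spaceDir i) (dirDeriv (spaceDir i) fun p => u p.1 p.2) (t, x) := by
  rw [InnerProductSpace.laplacian_eq_iteratedFDeriv_orthonormalBasis _
    (EuclideanSpace.basisFun (Fin 3) ℝ)]
  refine Finset.sum_congr rfl fun i _ => ?_
  have hut : ContDiff ℝ ∞ (u t) := hu.comp (contDiff_const.prodMk contDiff_id)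
  have hd : DifferentiableAt ℝ (fderiv ℝ (u t)) x :=
    (hut.fderiv_right (m := ∞) (by simp)).differentiable (by simp) x
  rw [iteratedFDeriv_two_apply]
  have h2 : ∀ b : E3, fderiv ℝ (fun y => fderiv ℝ (u t) y b) x b =
      fderiv ℝ (fderiv ℝ (u t)) x b b := by
    intro b
    rw [(hd.hasFDerivAt.clm_apply (hasFDerivAt_const b x)).fderiv]; simp
  have h3 := dirDeriv_space_eq ((hu.dirDeriv (spaceDir i)).differentiable (by simp)) t x
    (EuclideanSpace.basisFun (Fin 3) ℝ i)
  simp_rw [← fderiv_slice_eq hu] at h3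
  rw [h2] at h3
  exact h3

theorem norm_gradient_eq (f : E3 → ℝ) (x : E3) : ‖∇ f x‖ = ‖fderiv ℝ f x‖ := by
  rw [gradient]; simp

theorem norm_fderiv_sq (f : E3 → ℝ) (x : E3) :
    ‖fderiv ℝ f x‖ ^ 2 = ∑ i, fderiv ℝ f x (EuclideanSpace.basisFun (Fin 3) ℝ i) ^ 2 := by
  rw [← norm_gradient_eq, ← (EuclideanSpace.basisFun (Fin 3) ℝ).sum_sq_norm_inner_left (∇ f x)]
  refine Finset.sum_congr rfl fun i _ => ?_
  rw [gradient, InnerProductSpace.toDual_symm_apply, Real.norm_eq_abs, sq_abs]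

theorem norm_gradient_slice_sq (hu : ContDiff ℝ ∞ fun p : ℝ × E3 => u p.1 p.2) (t : ℝ) (x : E3) :
    ‖∇ (u t) x‖ ^ 2 = ∑ i, dirDeriv (spaceDir i) (fun p => u p.1 p.2) (t, x) ^ 2 := by
  rw [norm_gradient_eq, norm_fderiv_sq]
  simp_rw [fderiv_slice_eq hu]

theorem energyDensity_eq (hu : ContDiff ℝ ∞ fun p : ℝ × E3 => u p.1 p.2) (t : ℝ) (x : E3) :
    energyDensity (fun p => u p.1 p.2) (t, x) = timeDeriv u t x ^ 2 + ‖∇ (u t) x‖ ^ 2 := by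
  rw [norm_gradient_slice_sq hu, timeDeriv_eq hu]; rfl

theorem dirDeriv_exp_neg {U : ℝ × E3 → ℝ} (hU : ContDiff ℝ ∞ U) (v : ℝ × E3) :
    dirDeriv v (fun p => Real.exp (-U p)) = fun p => Real.exp (-U p) * -dirDeriv v U p := by
  ext p
  rw [dirDeriv, ((hU.differentiable (by simp) p).hasFDerivAt.fun_neg.exp).fderiv]
  simp [dirDeriv]

theorem dirDeriv_neg_log {V : ℝ × E3 → ℝ} (hV : ContDiff ℝ ∞ V) (hpos : ∀ p, 0 < V p)
    (v : ℝ × E3) :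
    dirDeriv v (fun p => -Real.log (V p)) = fun p => -((V p)⁻¹ * dirDeriv v V p) := by
  ext p
  rw [dirDeriv, (((hV.differentiable (by simp) p).hasFDerivAt.log (hpos p).ne').fun_neg).fderiv]
  simp [dirDeriv]

/-- $\partial_v^2e^{-U}=e^{-U}\big((\partial_vU)^2-\partial_v^2U\big)$; combined with the signs of
the wave operator, the bracket is the nonlinear equation. -/
theorem isLinearWave_exp_neg {U : ℝ × E3 → ℝ} (hU : ContDiff ℝ ∞ U)
    (h : ∀ p, dirDeriv timeDir (dirDeriv timeDir U) p -
      ∑ i, dirDeriv (spaceDir i) (dirDeriv (spaceDir i) U) p =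
      dirDeriv timeDir U p ^ 2 - ∑ i, dirDeriv (spaceDir i) U p ^ 2) :
    IsLinearWave fun p => Real.exp (-U p) where
  smooth := hU.neg.exp
  equation p := by
    have h2 : ∀ v, dirDeriv v (dirDeriv v fun p => Real.exp (-U p)) p =
        Real.exp (-U p) * (dirDeriv v U p ^ 2 - dirDeriv v (dirDeriv v U) p) := by
      intro v
      rw [dirDeriv_exp_neg hU, dirDeriv_mul hU.neg.exp (hU.dirDeriv v).neg, dirDeriv_exp_neg hU,
        dirDeriv_neg]
      ring
    simp_rw [h2, ← Finset.mul_sum, Finset.sum_sub_distrib]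
    congr 1
    linarith [h p]

/-- $\partial_v^2(-\log V)=V^{-2}(\partial_vV)^2-V^{-1}\partial_v^2V$; the wave operator kills the
last terms, and the first ones form the right-hand side. -/
theorem neg_log_equation {V : ℝ × E3 → ℝ} (hV : IsLinearWave V) (hpos : ∀ p, 0 < V p)
    (p : ℝ × E3) :
    dirDeriv timeDir (dirDeriv timeDir fun p => -Real.log (V p)) p -
      ∑ i, dirDeriv (spaceDir i) (dirDeriv (spaceDir i) fun p => -Real.log (V p)) p =
      dirDeriv timeDir (fun p => -Real.log (V p)) p ^ 2 -
        ∑ i, dirDeriv (spaceDir i) (fun p => -Real.log (V p)) p ^ 2 := by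
  have hne : ∀ p, V p ≠ 0 := fun p => (hpos p).ne'
  have hlog : ContDiff ℝ ∞ fun p => (V p)⁻¹ := hV.smooth.inv hne
  have hinv : ∀ v, dirDeriv v (fun p => (V p)⁻¹) p = -(((V p)⁻¹) ^ 2 * dirDeriv v V p) := by
    intro v
    rw [dirDeriv, show (fun p => (V p)⁻¹) = (fun y => y⁻¹) ∘ V from rfl,
      ((hasDerivAt_inv (hne p)).comp_hasFDerivAt p
        (hV.smooth.differentiable (by simp) p).hasFDerivAt).fderiv]
    simp [dirDeriv]
  have h2 : ∀ v, dirDeriv v (dirDeriv v fun p => -Real.log (V p)) p =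
      ((V p)⁻¹) ^ 2 * dirDeriv v V p ^ 2 - (V p)⁻¹ * dirDeriv v (dirDeriv v V) p := by
    intro v
    rw [dirDeriv_neg_log hV.smooth hpos, dirDeriv_neg]
    beta_reduce
    rw [dirDeriv_mul hlog (hV.smooth.dirDeriv v), hinv]
    ring
  simp_rw [h2, dirDeriv_neg_log hV.smooth hpos, hV.equation, Finset.sum_sub_distrib,
    ← Finset.mul_sum, neg_sq, mul_pow, ← Finset.mul_sum]
  ring

end Bridge

/-! ### Radial waves as means of a one-dimensional profile. -/

/-- The mean of `h` over `[t - ρ, t + ρ]` with weight `(1 - s ^ 2) ^ k`. -/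
noncomputable def weightedMean (k : ℕ) (h : ℝ → ℝ) (p : ℝ × ℝ) : ℝ :=
  ∫ s in (-1 : ℝ)..1, (1 - s ^ 2) ^ k * h (p.1 + p.2 * s)

theorem hasFDerivAt_weightedMean (k : ℕ) {h : ℝ → ℝ} (hh : ContDiff ℝ ∞ h) (p : ℝ × ℝ) :
    HasFDerivAt (weightedMean k h)
      (∫ s in (-1 : ℝ)..1, ((1 - s ^ 2) ^ k * deriv h (p.1 + p.2 * s)) •
        (ContinuousLinearMap.fst ℝ ℝ ℝ + s • ContinuousLinearMap.snd ℝ ℝ ℝ)) p := by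
  have hc' : Continuous (deriv h) := hh.continuous_deriv (by simp)
  have hdiff : Differentiable ℝ h := hh.differentiable (by simp)
  -- `C` bounds `deriv h` at every argument that arises from the unit ball around `p`; the further
  -- factor 2 in the dominating function bounds the norm of `fst + s • snd`.
  obtain ⟨C, hC⟩ := (isCompact_Icc (a := -(|p.1| + |p.2| + 2)) (b := |p.1| + |p.2| + 2)).exists_bound_of_continuousOn
    hc'.continuousOn
  refine intervalIntegral.hasFDerivAt_integral_of_dominated_of_fderiv_le
    (F' := fun (q : ℝ × ℝ) s => ((1 - s ^ 2) ^ k * deriv h (q.1 + q.2 * s)) •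
        (ContinuousLinearMap.fst ℝ ℝ ℝ + s • ContinuousLinearMap.snd ℝ ℝ ℝ))
    (bound := fun _ => C * 2) (s := Metric.ball p 1)
    (Metric.ball_mem_nhds p one_pos) ?_ ?_ ?_ ?_ ?_ ?_
  · refine Eventually.of_forall fun q => Continuous.aestronglyMeasurable ?_
    have := hh.continuous
    fun_prop
  · refine Continuous.intervalIntegrable ?_ _ _
    have := hh.continuous
    fun_prop
  · refine Continuous.aestronglyMeasurable ?_
    fun_prop
  · refine ae_of_all _ fun s hs q hq => ?_
    rw [uIoc_of_le (by norm_num)] at hs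
    have hs1 : |s| ≤ 1 := abs_le.2 ⟨hs.1.le, hs.2⟩
    have hs2 : s ^ 2 ≤ 1 := by rwa [sq_le_one_iff_abs_le_one]
    rw [mem_ball_iff_norm, Prod.norm_def, max_lt_iff] at hq
    have h1 : |q.1 - p.1| < 1 := hq.1
    have h2 : |q.2 - p.2| < 1 := hq.2
    have h3 : |q.1| ≤ |p.1| + 1 := by
      have := abs_add_le (q.1 - p.1) p.1; simp only [sub_add_cancel] at this; linarith
    have h4 : |q.2| ≤ |p.2| + 1 := by
      have := abs_add_le (q.2 - p.2) p.2; simp only [sub_add_cancel] at this; linarith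
    have h5 : |q.1 + q.2 * s| ≤ |p.1| + |p.2| + 2 := by
      have h6 : |q.2 * s| ≤ |q.2| := by
        rw [abs_mul]; exact mul_le_of_le_one_right (abs_nonneg _) hs1
      linarith [abs_add_le q.1 (q.2 * s)]
    have h7 := hC _ (abs_le.1 h5)
    have h8 : ‖ContinuousLinearMap.fst ℝ ℝ ℝ + s • ContinuousLinearMap.snd ℝ ℝ ℝ‖ ≤ 2 := by
      refine (norm_add_le _ _).trans ?_
      rw [norm_smul]
      have := ContinuousLinearMap.norm_fst_le ℝ ℝ ℝ
      have := ContinuousLinearMap.norm_snd_le ℝ ℝ ℝ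
      have : ‖s‖ * ‖ContinuousLinearMap.snd ℝ ℝ ℝ‖ ≤ 1 * 1 := by gcongr; exact hs1
      linarith
    rw [norm_smul, norm_mul]
    have h9 : ‖(1 - s ^ 2) ^ k‖ ≤ 1 := by
      rw [norm_pow, Real.norm_eq_abs, abs_of_nonneg (by linarith)]
      exact pow_le_one₀ (by linarith) (by nlinarith [sq_nonneg s])
    have hC0 : 0 ≤ C := (norm_nonneg _).trans h7
    gcongr
    calc ‖(1 - s ^ 2) ^ k‖ * ‖deriv h (q.1 + q.2 * s)‖ ≤ 1 * C := by gcongr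
      _ = C := one_mul C
  · exact intervalIntegrable_const
  · refine ae_of_all _ fun s _ q _ => ?_
    have hlin : HasFDerivAt (fun q : ℝ × ℝ => q.1 + q.2 * s)
        (ContinuousLinearMap.fst ℝ ℝ ℝ + s • ContinuousLinearMap.snd ℝ ℝ ℝ) q :=
      (hasFDerivAt_fst (𝕜 := ℝ)).add ((hasFDerivAt_snd (𝕜 := ℝ)).mul_const s)
    have := ((hdiff (q.1 + q.2 * s)).hasDerivAt.comp_hasFDerivAt q hlin).const_mul ((1 - s ^ 2) ^ k)
    rw [smul_smul] at this
    exact this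

/-- Integration by parts: $s(1-s^2)^k$ is the derivative of $-(1-s^2)^{k+1}/(2(k+1))$, which
vanishes at $\pm1$. The factor $\rho$ gained here cancels the singularity of $\nabla|x|=x/|x|$ at
the origin. -/
theorem integral_weight_mul_id (k : ℕ) {h : ℝ → ℝ} (hh : ContDiff ℝ ∞ h) (t ρ : ℝ) :
    ∫ s in (-1 : ℝ)..1, (1 - s ^ 2) ^ k * h (t + ρ * s) * s =
      ρ / (2 * (k + 1)) * weightedMean (k + 1) (deriv h) (t, ρ) := by
  have hc := hh.continuous
  have hc' : Continuous (deriv h) := hh.continuous_deriv (by simp)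
  have hdiff : Differentiable ℝ h := hh.differentiable (by simp)
  have hk : (k : ℝ) + 1 ≠ 0 := by positivity
  have hd : ∀ s : ℝ, HasDerivAt (fun s => (1 - s ^ 2) ^ (k + 1) * h (t + ρ * s))
      (-(2 * (k + 1)) * ((1 - s ^ 2) ^ k * h (t + ρ * s) * s) +
        ρ * ((1 - s ^ 2) ^ (k + 1) * deriv h (t + ρ * s))) s := by
    intro s
    have h1 : HasDerivAt (fun s : ℝ => (1 - s ^ 2) ^ (k + 1)) _ s :=
      ((hasDerivAt_pow 2 s).const_sub 1).fun_pow (k + 1)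
    have h2 : HasDerivAt (fun s : ℝ => h (t + ρ * s)) _ s :=
      (hdiff (t + ρ * s)).hasDerivAt.comp s (((hasDerivAt_id s).const_mul ρ).const_add t)
    refine (h1.mul h2).congr_deriv ?_
    push_cast [Nat.add_sub_cancel]
    ring
  have hint := intervalIntegral.integral_eq_sub_of_hasDerivAt (a := -1) (b := 1)
    (fun s _ => hd s) (Continuous.intervalIntegrable (by fun_prop) _ _)
  rw [intervalIntegral.integral_add (Continuous.intervalIntegrable (by fun_prop) _ _)
    (Continuous.intervalIntegrable (by fun_prop) _ _), intervalIntegral.integral_const_mul,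
    intervalIntegral.integral_const_mul] at hint
  norm_num at hint
  rw [weightedMean, div_mul_eq_mul_div, eq_div_iff (by positivity)]
  linarith

theorem hasFDerivAt_weightedMean' (k : ℕ) {h : ℝ → ℝ} (hh : ContDiff ℝ ∞ h) (p : ℝ × ℝ) :
    HasFDerivAt (weightedMean k h)
      (weightedMean k (deriv h) p • ContinuousLinearMap.fst ℝ ℝ ℝ +
        (p.2 / (2 * (k + 1)) * weightedMean (k + 1) (deriv (deriv h)) p) •
          ContinuousLinearMap.snd ℝ ℝ ℝ) p := by
  have hh' : ContDiff ℝ ∞ (deriv h) := by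
    rw [contDiff_infty_iff_deriv] at hh; exact hh.2
  have hc' := hh'.continuous
  convert hasFDerivAt_weightedMean k hh p using 1
  simp_rw [smul_add, smul_smul]
  rw [intervalIntegral.integral_add (Continuous.intervalIntegrable (by fun_prop) _ _)
    (Continuous.intervalIntegrable (by fun_prop) _ _), intervalIntegral.integral_smul_const,
    intervalIntegral.integral_smul_const, integral_weight_mul_id k hh']
  rfl

/-- The derivative of a function of time and radius whose radial derivative is `‖x‖ * b`. -/
theorem hasFDerivAt_comp_norm {A : ℝ × ℝ → ℝ} {a b : ℝ} (p : ℝ × E3)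
    (hA : HasFDerivAt A (a • ContinuousLinearMap.fst ℝ ℝ ℝ +
      (‖p.2‖ * b) • ContinuousLinearMap.snd ℝ ℝ ℝ) (p.1, ‖p.2‖)) :
    HasFDerivAt (fun p : ℝ × E3 => A (p.1, ‖p.2‖))
      (a • ContinuousLinearMap.fst ℝ ℝ E3 +
        b • (innerSL ℝ p.2 ∘L ContinuousLinearMap.snd ℝ ℝ E3)) p := by
  rcases eq_or_ne p.2 0 with hx | hx
  -- The norm is not differentiable at $0$, but the radial part of the derivative of `A` carries the
  -- factor $\|x\|=0$; the error estimate transfers because $(t,x)\mapsto(t,\|x\|)$ preserves norms.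
  · rw [hx] at hA ⊢
    rw [hasFDerivAt_iff_isLittleO_nhds_zero] at hA ⊢
    have ht : Tendsto (fun q : ℝ × E3 => (q.1, ‖q.2‖)) (𝓝 0) (𝓝 (0 : ℝ × ℝ)) := by
      have : Continuous fun q : ℝ × E3 => (q.1, ‖q.2‖) := by fun_prop
      exact (this.tendsto' 0 0 (by simp))
    have h2 := hA.comp_tendsto ht
    refine (h2.trans_isBigO ?_).congr_left ?_
    · exact Asymptotics.isBigO_of_le _ fun q => by simp [Prod.norm_def]
    · intro q
      simp [hx]
  · have hn : HasFDerivAt (fun q : ℝ × E3 => (q.1, ‖q.2‖))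
        ((ContinuousLinearMap.fst ℝ ℝ E3).prod
          ((‖p.2‖⁻¹ • innerSL ℝ p.2) ∘L ContinuousLinearMap.snd ℝ ℝ E3)) p := by
      refine hasFDerivAt_fst.prodMk ?_
      have h1 : HasFDerivAt (fun x : E3 => ‖x‖) (‖p.2‖⁻¹ • innerSL ℝ p.2) p.2 := by
        have h := (hasStrictFDerivAt_norm_sq p.2).hasFDerivAt.sqrt
          (by positivity : ‖p.2‖ ^ 2 ≠ 0)
        simp only [Real.sqrt_sq (norm_nonneg _)] at h
        refine h.congr_fderiv ?_
        ext v
        simp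
        field_simp
      exact h1.comp p hasFDerivAt_snd
    have h3 : HasFDerivAt (fun p : ℝ × E3 => A (p.1, ‖p.2‖)) _ p := hA.comp p hn
    refine h3.congr_fderiv ?_
    ext v
    · simp
    · have : ‖p.2‖ ≠ 0 := norm_ne_zero_iff.2 hx
      simp
      field_simp

/-- The radial extension of the weighted mean to space-time. -/
noncomputable def radialMean (k : ℕ) (h : ℝ → ℝ) (p : ℝ × E3) : ℝ :=
  weightedMean k h (p.1, ‖p.2‖)

theorem hasFDerivAt_radialMean (k : ℕ) {h : ℝ → ℝ} (hh : ContDiff ℝ ∞ h) (p : ℝ × E3) :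
    HasFDerivAt (radialMean k h)
      (radialMean k (deriv h) p • ContinuousLinearMap.fst ℝ ℝ E3 +
        ((2 * ((k : ℝ) + 1))⁻¹ * radialMean (k + 1) (deriv (deriv h)) p) •
          (innerSL ℝ p.2 ∘L ContinuousLinearMap.snd ℝ ℝ E3)) p := by
  refine hasFDerivAt_comp_norm p ?_
  convert hasFDerivAt_weightedMean' k hh (p.1, ‖p.2‖) using 3
  · rfl
  · rw [show radialMean (k + 1) (deriv (deriv h)) p =
      weightedMean (k + 1) (deriv (deriv h)) (p.1, ‖p.2‖) from rfl]
    ring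

theorem contDiff_deriv_of_infty {h : ℝ → ℝ} (hh : ContDiff ℝ ∞ h) : ContDiff ℝ ∞ (deriv h) :=
  (contDiff_infty_iff_deriv.1 hh).2

/-- The derivative of a mean is built from means of $h'$ and $h''$ with exponents $k$ and $k+1$, so
the induction on the order of smoothness must run over all `k` and `h` at once. -/
theorem contDiff_radialMean (k : ℕ) {h : ℝ → ℝ} (hh : ContDiff ℝ ∞ h) :
    ContDiff ℝ ∞ (radialMean k h) := by
  rw [contDiff_infty]
  intro n
  induction n generalizing k h with
  | zero =>
    rw [Nat.cast_zero, contDiff_zero]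
    exact continuous_iff_continuousAt.2 fun p => (hasFDerivAt_radialMean k hh p).continuousAt
  | succ n ih =>
    rw [Nat.cast_add, Nat.cast_one, contDiff_succ_iff_hasFDerivAt]
    refine ⟨_, ?_, hasFDerivAt_radialMean k hh⟩
    have h' := contDiff_deriv_of_infty hh
    refine ((ih k h').smul contDiff_const).add ((contDiff_const.mul
      (ih (k + 1) (contDiff_deriv_of_infty h'))).smul ?_)
    exact (((innerSL ℝ).contDiff.comp contDiff_snd).clm_comp contDiff_const)

theorem dirDeriv_time_radialMean (k : ℕ) {h : ℝ → ℝ} (hh : ContDiff ℝ ∞ h) :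
    dirDeriv timeDir (radialMean k h) = radialMean k (deriv h) := by
  ext p
  rw [dirDeriv, (hasFDerivAt_radialMean k hh p).fderiv]
  simp [timeDir]

theorem dirDeriv_space_radialMean (k : ℕ) {h : ℝ → ℝ} (hh : ContDiff ℝ ∞ h) (i : Fin 3) :
    dirDeriv (spaceDir i) (radialMean k h) = fun p =>
      (2 * ((k : ℝ) + 1))⁻¹ * radialMean (k + 1) (deriv (deriv h)) p * p.2 i := by
  ext p
  rw [dirDeriv, (hasFDerivAt_radialMean k hh p).fderiv]
  simp [spaceDir, EuclideanSpace.inner_single_right]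

/-- Two integrations by parts, the second with $s-s^3$, whose derivative is $1-3s^2=3(1-s^2)-2$.
With $h''$ in place of $h$, this reduces the Laplacian of the mean to a mean of $h''$. -/
theorem norm_sq_mul_radialMean_two {h : ℝ → ℝ} (hh : ContDiff ℝ ∞ h) (p : ℝ × E3) :
    ‖p.2‖ ^ 2 * radialMean 2 (deriv (deriv h)) p =
      8 * radialMean 0 h p - 12 * radialMean 1 h p := by
  have hc := hh.continuous
  have h' := contDiff_deriv_of_infty hh
  have h1 := integral_weight_mul_id 1 h' p.1 ‖p.2‖
  have hdiff : Differentiable ℝ h := hh.differentiable (by simp)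
  have hc' := h'.continuous
  have hd : ∀ s : ℝ, HasDerivAt (fun s => (s - s ^ 3) * h (p.1 + ‖p.2‖ * s))
      ((1 - 3 * s ^ 2) * h (p.1 + ‖p.2‖ * s) +
        ‖p.2‖ * ((1 - s ^ 2) ^ 1 * deriv h (p.1 + ‖p.2‖ * s) * s)) s := by
    intro s
    have h1 : HasDerivAt (fun s : ℝ => s - s ^ 3) _ s :=
      (hasDerivAt_id s).sub (hasDerivAt_pow 3 s)
    have h2 : HasDerivAt (fun s : ℝ => h (p.1 + ‖p.2‖ * s)) _ s :=
      (hdiff (p.1 + ‖p.2‖ * s)).hasDerivAt.comp s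
        (((hasDerivAt_id s).const_mul ‖p.2‖).const_add p.1)
    refine (h1.mul h2).congr_deriv ?_
    simp
    ring
  have hint := intervalIntegral.integral_eq_sub_of_hasDerivAt (a := -1) (b := 1)
    (fun s _ => hd s) (Continuous.intervalIntegrable (by fun_prop) _ _)
  rw [intervalIntegral.integral_add (Continuous.intervalIntegrable (by fun_prop) _ _)
    (Continuous.intervalIntegrable (by fun_prop) _ _), intervalIntegral.integral_const_mul, h1]
    at hint
  have h3 : ∫ s in (-1 : ℝ)..1, (1 - 3 * s ^ 2) * h (p.1 + ‖p.2‖ * s) =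
      3 * radialMean 1 h p - 2 * radialMean 0 h p := by
    rw [radialMean, radialMean, weightedMean, weightedMean,
      ← intervalIntegral.integral_const_mul, ← intervalIntegral.integral_const_mul,
      ← intervalIntegral.integral_sub (Continuous.intervalIntegrable (by fun_prop) _ _)
      (Continuous.intervalIntegrable (by fun_prop) _ _)]
    congr 1; ext s; simp; ring
  rw [h3] at hint
  norm_num at hint
  rw [radialMean]
  linarith

/-- Half the mean of `h` over `[t - |x|, t + |x|]` solves the wave equation. -/
theorem isLinearWave_radialMean {h : ℝ → ℝ} (hh : ContDiff ℝ ∞ h) :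
    IsLinearWave fun p => 2⁻¹ * radialMean 0 h p where
  smooth := contDiff_const.mul (contDiff_radialMean 0 hh)
  equation p := by
    have h1 := contDiff_deriv_of_infty hh
    have h2 := contDiff_deriv_of_infty h1
    have hcm : ∀ (c : ℝ) (f : ℝ × E3 → ℝ) (v : ℝ × E3), ContDiff ℝ ∞ f →
        dirDeriv v (fun p => c * f p) = fun p => c * dirDeriv v f p := by
      intro c f v hf
      ext p
      rw [dirDeriv_mul contDiff_const hf]; simp [dirDeriv]
    have hR := fun k => contDiff_radialMean k hh
    have hR2 := fun k => contDiff_radialMean k h2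
    have hcoord : ∀ i : Fin 3, ContDiff ℝ ∞ fun p : ℝ × E3 => p.2 i := fun i =>
      ((EuclideanSpace.proj i : E3 →L[ℝ] ℝ).contDiff).comp contDiff_snd
    have hdc : ∀ i, dirDeriv (spaceDir i) (fun p : ℝ × E3 => p.2 i) p = 1 := by
      intro i
      have : HasFDerivAt (fun p : ℝ × E3 => p.2 i) _ p :=
        ((EuclideanSpace.proj i : E3 →L[ℝ] ℝ).hasFDerivAt).comp p
          hasFDerivAt_snd
      rw [dirDeriv, this.fderiv]; simp [spaceDir]
    have hs : ∀ i, dirDeriv (spaceDir i)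
        (dirDeriv (spaceDir i) fun p => 2⁻¹ * radialMean 0 h p) p =
        4⁻¹ * (radialMean 1 (deriv (deriv h)) p +
          4⁻¹ * radialMean 2 (deriv (deriv (deriv (deriv h)))) p * p.2 i ^ 2) := by
      intro i
      rw [hcm _ _ _ (hR 0), dirDeriv_space_radialMean 0 hh, hcm _ _ _
        ((contDiff_const.mul (hR2 _)).mul (hcoord i))]
      beta_reduce
      rw [dirDeriv_mul (contDiff_const.mul (hR2 _)) (hcoord i), hcm _ _ _ (hR2 _),
        dirDeriv_space_radialMean 1 h2, hdc]
      norm_num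
      ring
    simp_rw [hs, hcm _ _ _ (hR 0), dirDeriv_time_radialMean 0 hh,
      hcm _ _ _ (contDiff_radialMean 0 h1), dirDeriv_time_radialMean 0 h1]
    have hn := norm_sq_mul_radialMean_two h2 p
    rw [EuclideanSpace.real_norm_sq_eq] at hn
    simp_rw [Fin.sum_univ_three] at hn ⊢
    linarith

/-! ### Integration in polar coordinates. -/

theorem lintegral_comp_norm {F : ℝ → ℝ≥0∞} (hF : Measurable F) :
    ∫⁻ x : E3, F ‖x‖ = 3 * volume (Metric.ball (0 : E3) 1) *
      ∫⁻ r in Ioi (0 : ℝ), ENNReal.ofReal (r ^ 2) * F r := by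
  have h3 : Module.finrank ℝ E3 = 3 := by simp
  calc ∫⁻ x : E3, F ‖x‖ = ∫⁻ x : ({0}ᶜ : Set E3), F ‖(x : E3)‖ ∂((volume : Measure E3).comap Subtype.val) := by
        rw [lintegral_subtype_comap (measurableSet_singleton _).compl fun x : E3 => F ‖x‖,
          restrict_compl_singleton]
    _ = ∫⁻ q : Metric.sphere (0 : E3) 1 × Ioi (0 : ℝ), F q.2
          ∂(volume : Measure E3).toSphere.prod (.volumeIoiPow (Module.finrank ℝ E3 - 1)) := by
        simpa using ((volume : Measure E3).measurePreserving_homeomorphUnitSphereProd).lintegral_comp_emb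
          (Homeomorph.measurableEmbedding _) (F ∘ Subtype.val ∘ Prod.snd)
    _ = (volume : Measure E3).toSphere univ *
          ∫⁻ r : Ioi (0 : ℝ), F r ∂(.volumeIoiPow (Module.finrank ℝ E3 - 1)) := by
        rw [lintegral_prod _ (by fun_prop)]
        simp only [lintegral_const]
        rw [mul_comm]
    _ = _ := by
        rw [Measure.toSphere_apply_univ, h3, Measure.volumeIoiPow,
          lintegral_withDensity_eq_lintegral_mul _ (by fun_prop) (by fun_prop)]
        simp only [Pi.mul_apply]
        rw [lintegral_subtype_comap measurableSet_Ioi fun r : ℝ => ENNReal.ofReal (r ^ (3 - 1)) * F r]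
        norm_num

/-- The left factor is the area $4\pi$ of the unit sphere; the crude bound by $1$ drops it from the
estimates. -/
theorem one_le_three_mul_volume_ball : 1 ≤ 3 * volume (Metric.ball (0 : E3) 1) := by
  rw [EuclideanSpace.volume_ball_fin_three, ENNReal.ofReal_one, one_pow, one_mul,
    show (3 : ℝ≥0∞) = ENNReal.ofReal 3 by simp, ← ENNReal.ofReal_mul (by norm_num),
    ENNReal.one_le_ofReal]
  linarith [Real.pi_gt_three]

theorem setLIntegral_sq_mul_le {F : ℝ → ℝ≥0∞} (hF : Measurable F) :
    ∫⁻ r in Ioi (0 : ℝ), ENNReal.ofReal (r ^ 2) * F r ≤ ∫⁻ x : E3, F ‖x‖ := by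
  rw [lintegral_comp_norm hF]
  exact le_mul_of_one_le_left zero_le one_le_three_mul_volume_ball

theorem lintegral_comp_norm_lt_top {F : ℝ → ℝ≥0∞} (hF : Measurable F)
    (h : ∫⁻ r in Ioi (0 : ℝ), ENNReal.ofReal (r ^ 2) * F r < ⊤) : ∫⁻ x : E3, F ‖x‖ < ⊤ := by
  rw [lintegral_comp_norm hF]
  exact ENNReal.mul_lt_top (ENNReal.mul_lt_top (by simp) measure_ball_lt_top) h

theorem lintegral_even_eq {F : ℝ → ℝ≥0∞} (heven : ∀ s, F (-s) = F s) :
    ∫⁻ s, F s = 2 * ∫⁻ s in Ioi (0 : ℝ), F s := by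
  have h1 : ∫⁻ s in Iic (0 : ℝ), F s = ∫⁻ s in Ioi (0 : ℝ), F s := by
    rw [setLIntegral_congr Iio_ae_eq_Iic.symm]
    have := (Measure.measurePreserving_neg (volume : Measure ℝ)).setLIntegral_comp_preimage_emb
      (Homeomorph.neg ℝ).measurableEmbedding F (Iio 0)
    simp only [heven] at this
    rw [← this]
    congr 2
    ext s; simp
  rw [← lintegral_add_compl F (measurableSet_Iic (a := (0 : ℝ))), compl_Iic, h1, two_mul]

/-! ### Radial functions and their one-dimensional profiles. -/

section Profile

/-- The profile of a radial function along a ray. -/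
noncomputable def profile (f : E3 → ℝ) (s : ℝ) : ℝ := f (s • EuclideanSpace.single 0 1)

variable {f : E3 → ℝ}

theorem contDiff_profile (hf : ContDiff ℝ ∞ f) : ContDiff ℝ ∞ (profile f) :=
  hf.comp (contDiff_id.smul contDiff_const)

theorem IsRadial.profile_eq (hr : IsRadial f) {s : ℝ} {x : E3} (h : |s| = ‖x‖) :
    profile f s = f x := hr _ _ (by simp [norm_smul, h])

theorem IsRadial.profile_norm (hr : IsRadial f) (x : E3) : profile f ‖x‖ = f x :=
  hr.profile_eq (abs_norm x)

theorem IsRadial.profile_neg (hr : IsRadial f) (s : ℝ) : profile f (-s) = profile f s :=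
  hr _ _ (by simp)

theorem IsRadial.deriv_profile_norm (hr : IsRadial f) (hf : ContDiff ℝ ∞ f) {x : E3} (hx : x ≠ 0) :
    deriv (profile f) ‖x‖ = radialDeriv f x := by
  have hx' : ‖x‖ ≠ 0 := norm_ne_zero_iff.2 hx
  have h1 : profile f = fun s : ℝ => f (s • (‖x‖⁻¹ • x)) := by
    ext s
    refine hr.profile_eq ?_
    rw [norm_smul, norm_smul, norm_inv, norm_norm, inv_mul_cancel₀ hx', mul_one, Real.norm_eq_abs]
  have h2 : HasDerivAt (fun s : ℝ => s • (‖x‖⁻¹ • x)) (‖x‖⁻¹ • x) ‖x‖ := by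
    simpa using (hasDerivAt_id ‖x‖).smul_const (‖x‖⁻¹ • x)
  have h3 : ‖x‖ • (‖x‖⁻¹ • x) = x := by rw [smul_smul, mul_inv_cancel₀ hx', one_smul]
  have h4 : HasFDerivAt f (fderiv ℝ f x) (‖x‖ • (‖x‖⁻¹ • x)) := by
    rw [h3]; exact (hf.differentiable (by simp) x).hasFDerivAt
  rw [h1]
  exact (h4.comp_hasDerivAt ‖x‖ h2).deriv

theorem deriv_neg_of_even {p : ℝ → ℝ} (hp : ∀ s, p (-s) = p s) (s : ℝ) :
    deriv p (-s) = -deriv p s := by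
  have h := deriv_comp_neg p s
  simp only [hp] at h
  linarith

theorem abs_radialDeriv_le (f : E3 → ℝ) {x : E3} (hx : x ≠ 0) : |radialDeriv f x| ≤ ‖∇ f x‖ := by
  rw [norm_gradient_eq]
  refine (ContinuousLinearMap.le_opNorm (fderiv ℝ f x) _).trans ?_
  rw [norm_smul, norm_inv, norm_norm, inv_mul_cancel₀ (norm_ne_zero_iff.2 hx), mul_one]

end Profile

/-! ### Initial values of the explicit wave, and its pointwise bounds. -/

section CauchyProfile

/-- The right-moving wave profile of the radial data `v₀, v₁`. -/
noncomputable def waveProfile (v₀ v₁ : E3 → ℝ) (s : ℝ) : ℝ :=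
  profile v₀ s + s * deriv (profile v₀) s + s * profile v₁ s

variable {v₀ v₁ : E3 → ℝ}

theorem contDiff_waveProfile (h₀ : ContDiff ℝ ∞ v₀) (h₁ : ContDiff ℝ ∞ v₁) :
    ContDiff ℝ ∞ (waveProfile v₀ v₁) :=
  ((contDiff_profile h₀).add (contDiff_id.mul (contDiff_deriv_of_infty (contDiff_profile h₀)))).add
    (contDiff_id.mul (contDiff_profile h₁))

theorem mul_radialMean_zero {h : ℝ → ℝ} (p : ℝ × E3) :
    ‖p.2‖ * radialMean 0 h p = ∫ s in (p.1 - ‖p.2‖)..(p.1 + ‖p.2‖), h s := by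
  simp only [radialMean, weightedMean, pow_zero, one_mul]
  rw [intervalIntegral.mul_integral_comp_add_mul]
  congr 1 <;> ring

theorem intervalIntegral_odd_eq_zero {g : ℝ → ℝ} (hg : ∀ s, g (-s) = -g s) (a : ℝ) :
    ∫ s in (-a)..a, g s = 0 := by
  have h := intervalIntegral.integral_comp_neg (a := -a) (b := a) g
  simp only [hg, intervalIntegral.integral_neg, neg_neg] at h
  linarith

/-- Over $[-r,r]$ the odd term $s\,v_1$ integrates to zero and $(s\,v_0)'$ gives $2r\,v_0(r)$. The
origin follows by continuity. -/
theorem half_radialMean_waveProfile (h₀ : ContDiff ℝ ∞ v₀) (h₁ : ContDiff ℝ ∞ v₁)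
    (hr₀ : IsRadial v₀) (hr₁ : IsRadial v₁) (x : E3) :
    2⁻¹ * radialMean 0 (waveProfile v₀ v₁) (0, x) = v₀ x := by
  have hh := contDiff_waveProfile h₀ h₁
  have hcl : Continuous fun x : E3 => 2⁻¹ * radialMean 0 (waveProfile v₀ v₁) (0, x) :=
    continuous_const.mul ((contDiff_radialMean 0 hh).continuous.comp (by fun_prop))
  refine congrFun (hcl.ext_on (dense_compl_singleton (0 : E3)) h₀.continuous fun x hx => ?_) x
  have hx' : ‖x‖ ≠ 0 := norm_ne_zero_iff.2 hx
  have h := mul_radialMean_zero (h := waveProfile v₀ v₁) (0, x)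
  have hp := contDiff_profile h₀
  have hd : ∀ s, HasDerivAt (fun s => s * profile v₀ s)
      (profile v₀ s + s * deriv (profile v₀) s) s := by
    intro s
    have := (hasDerivAt_id s).fun_mul (hp.differentiable (by simp) s).hasDerivAt
    simpa using this
  have hc1 := hp.continuous
  have hc2 := (contDiff_deriv_of_infty hp).continuous
  have hc3 := (contDiff_profile h₁).continuous
  have hint := intervalIntegral.integral_eq_sub_of_hasDerivAt (a := -‖x‖) (b := ‖x‖)
    (fun s _ => hd s) (Continuous.intervalIntegrable (by fun_prop) _ _)
  have hodd : ∫ s in (-‖x‖)..‖x‖, s * profile v₁ s = 0 :=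
    intervalIntegral_odd_eq_zero (fun s => by rw [hr₁.profile_neg]; ring) _
  simp only [zero_sub, zero_add] at h
  unfold waveProfile at h
  rw [intervalIntegral.integral_add (Continuous.intervalIntegrable (by fun_prop) _ _)
    (Continuous.intervalIntegrable (by fun_prop) _ _), hint, hodd, hr₀.profile_neg,
    hr₀.profile_norm] at h
  refine mul_left_cancel₀ hx' ?_
  have h' : ‖x‖ * radialMean 0 (waveProfile v₀ v₁) (0, x) = 2 * (‖x‖ * v₀ x) := by
    unfold waveProfile; rw [h]; ring
  linear_combination 2⁻¹ * h'

/-- Here the integral is $h(r)-h(-r)$, in which only the odd part $s\,v_1$ of the profile remains.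
-/
theorem half_radialMean_deriv_waveProfile (h₀ : ContDiff ℝ ∞ v₀) (h₁ : ContDiff ℝ ∞ v₁)
    (hr₀ : IsRadial v₀) (hr₁ : IsRadial v₁) (x : E3) :
    2⁻¹ * radialMean 0 (deriv (waveProfile v₀ v₁)) (0, x) = v₁ x := by
  have hh := contDiff_waveProfile h₀ h₁
  have hh' := contDiff_deriv_of_infty hh
  have hcl : Continuous fun x : E3 => 2⁻¹ * radialMean 0 (deriv (waveProfile v₀ v₁)) (0, x) :=
    continuous_const.mul ((contDiff_radialMean 0 hh').continuous.comp (by fun_prop))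
  refine congrFun (hcl.ext_on (dense_compl_singleton (0 : E3)) h₁.continuous fun x hx => ?_) x
  have hx' : ‖x‖ ≠ 0 := norm_ne_zero_iff.2 hx
  have h := mul_radialMean_zero (h := deriv (waveProfile v₀ v₁)) (0, x)
  have hint := intervalIntegral.integral_deriv_eq_sub (a := -‖x‖) (b := ‖x‖)
    (fun s _ => (hh.differentiable (by simp) s)) (hh'.continuous.intervalIntegrable _ _)
  simp only [zero_sub, zero_add] at h
  rw [hint] at h
  simp only [waveProfile, hr₀.profile_neg, deriv_neg_of_even hr₀.profile_neg, hr₁.profile_neg,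
    hr₁.profile_norm] at h
  refine mul_left_cancel₀ hx' ?_
  have h' : ‖x‖ * radialMean 0 (deriv (waveProfile v₀ v₁)) (0, x) = 2 * (‖x‖ * v₁ x) := by
    rw [h]; ring
  linear_combination 2⁻¹ * h'

theorem le_half_radialMean {h : ℝ → ℝ} (hc : Continuous h) {m : ℝ} (hm : ∀ s, m ≤ h s)
    (p : ℝ × E3) : m ≤ 2⁻¹ * radialMean 0 h p := by
  have h1 : ∫ s in (-1 : ℝ)..1, m ≤ ∫ s in (-1 : ℝ)..1, h (p.1 + ‖p.2‖ * s) :=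
    intervalIntegral.integral_mono_on (by norm_num) intervalIntegrable_const
      (Continuous.intervalIntegrable (by fun_prop) _ _) fun s _ => hm _
  rw [intervalIntegral.integral_const] at h1
  simp only [radialMean, weightedMean, pow_zero, one_mul]
  norm_num at h1
  linarith

theorem half_radialMean_sub_one {h : ℝ → ℝ} (hc : Continuous h) (p : ℝ × E3) :
    2⁻¹ * radialMean 0 h p - 1 = 2⁻¹ * radialMean 0 (fun s => h s - 1) p := by
  simp only [radialMean, weightedMean, pow_zero, one_mul]
  rw [intervalIntegral.integral_sub (Continuous.intervalIntegrable (by fun_prop) _ _)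
    intervalIntegrable_const, intervalIntegral.integral_const]
  norm_num
  ring

/-- The mean over $[t-r,t+r]$ competes in the maximal function at every point `y` of the interval,
not only at its centre; the $L^6$ bound exploits this freedom. -/
theorem enorm_half_radialMean_le {g : ℝ → ℝ} {p : ℝ × E3} {y : ℝ}
    (hy : y ∈ Metric.ball p.1 ‖p.2‖) :
    ‖2⁻¹ * radialMean 0 g p‖ₑ ≤ maximalFunction (fun s => ‖g s‖ₑ) y := by
  refine le_trans ?_ (average_le_maximalFunction _ hy)
  have hr : 0 < ‖p.2‖ := Metric.pos_of_mem_ball hy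
  rw [ENNReal.le_div_iff_mul_le (Or.inl (by simpa using hr)) (Or.inl ENNReal.ofReal_ne_top)]
  have h1 : ‖2⁻¹ * radialMean 0 g p‖ₑ * ENNReal.ofReal (2 * ‖p.2‖) =
      ‖∫ s in (p.1 - ‖p.2‖)..(p.1 + ‖p.2‖), g s‖ₑ := by
    rw [← mul_radialMean_zero, ← Real.enorm_of_nonneg (by positivity : 0 ≤ 2 * ‖p.2‖), ← enorm_mul]
    congr 1; ring
  rw [h1, intervalIntegral.integral_of_le (by linarith), integral_Ioc_eq_integral_Ioo,
    Real.ball_eq_Ioo]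
  exact enorm_integral_le_lintegral_enorm _

end CauchyProfile

/-! ### Square integrability of the profile and the spatial $L^6$ bound. -/

section FiniteEnergy

theorem setLIntegral_Ioi_le_of_forall_exists {F : ℝ → ℝ≥0∞} {B : ℝ≥0∞}
    (h : ∀ δ > (0 : ℝ), ∀ N : ℝ, ∃ R ≥ N, ∫⁻ s in Ioc 0 R, F s ≤ B + ENNReal.ofReal δ) :
    ∫⁻ s in Ioi (0 : ℝ), F s ≤ B := by
  have hU : Ioi (0 : ℝ) = ⋃ n : ℕ, Ioc 0 (n : ℝ) := by
    ext s
    simp only [mem_Ioi, mem_iUnion, mem_Ioc]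
    refine ⟨fun hs => ?_, fun ⟨n, hn⟩ => hn.1⟩
    obtain ⟨n, hn⟩ := exists_nat_ge s
    exact ⟨n, hs, hn⟩
  have hdir : Directed (· ⊆ ·) fun n : ℕ => Ioc 0 (n : ℝ) :=
    (monotone_nat_of_le_succ fun n => Ioc_subset_Ioc_right (by simp)).directed_le
  rw [hU, setLIntegral_iUnion_of_directed _ hdir]
  refine iSup_le fun n => ENNReal.le_of_forall_pos_le_add fun δ hδ _ => ?_
  obtain ⟨R, hR, hle⟩ := h δ hδ n
  refine (lintegral_mono_set (Ioc_subset_Ioc_right hR)).trans (hle.trans ?_)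
  rw [ENNReal.ofReal_coe_nnreal]

/-- For `q` decaying along a sequence, `∫ ((s q)')² ≤ ∫ (s q')²` on the half line. -/
theorem setLIntegral_deriv_mul_sq_le {q : ℝ → ℝ} (hq : ContDiff ℝ ∞ q)
    (hdecay : ∀ δ > (0 : ℝ), ∀ N : ℝ, ∃ R ≥ N, R * q R ^ 2 ≤ δ) :
    ∫⁻ s in Ioi (0 : ℝ), ENNReal.ofReal ((q s + s * deriv q s) ^ 2) ≤
      ∫⁻ s in Ioi (0 : ℝ), ENNReal.ofReal ((s * deriv q s) ^ 2) := by
  have hc := hq.continuous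
  have hc' := (contDiff_deriv_of_infty hq).continuous
  refine setLIntegral_Ioi_le_of_forall_exists fun δ hδ N => ?_
  obtain ⟨R, hR, hRq⟩ := hdecay δ hδ (max N 0)
  have hR0 : 0 ≤ R := (le_max_right _ _).trans hR
  refine ⟨R, (le_max_left _ _).trans hR, ?_⟩
  have hd : ∀ s, HasDerivAt (fun s => s * q s ^ 2) (q s ^ 2 + s * (2 * q s * deriv q s)) s := by
    intro s
    have := (hasDerivAt_id s).fun_mul ((hq.differentiable (by simp) s).hasDerivAt.fun_pow 2)
    simpa using this
  have hint := intervalIntegral.integral_eq_sub_of_hasDerivAt (a := 0) (b := R)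
    (fun s _ => hd s) (Continuous.intervalIntegrable (by fun_prop) _ _)
  -- Pointwise $(q+sq')^2=(sq')^2+(s\,q^2)'$, so the two integrals differ only by the boundary term.
  have hsplit : ∫ s in (0 : ℝ)..R, (q s + s * deriv q s) ^ 2 =
      (∫ s in (0 : ℝ)..R, (s * deriv q s) ^ 2) + R * q R ^ 2 := by
    have h2 : R * q R ^ 2 = ∫ s in (0 : ℝ)..R, q s ^ 2 + s * (2 * q s * deriv q s) := by
      rw [hint]; ring
    rw [h2, ← intervalIntegral.integral_add (Continuous.intervalIntegrable (by fun_prop) _ _)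
      (Continuous.intervalIntegrable (by fun_prop) _ _)]
    congr 1; ext s; ring
  have hconv : ∀ F : ℝ → ℝ, Continuous F → (∀ s, 0 ≤ F s) →
      ∫⁻ s in Ioc 0 R, ENNReal.ofReal (F s) = ENNReal.ofReal (∫ s in (0 : ℝ)..R, F s) := by
    intro F hF hF0
    rw [intervalIntegral.integral_of_le hR0, ofReal_integral_eq_lintegral_ofReal
      (hF.integrableOn_Icc.mono_set Ioc_subset_Icc_self) (ae_of_all _ hF0)]
  rw [hconv _ (by fun_prop) fun s => sq_nonneg _, hsplit,
    ENNReal.ofReal_add (intervalIntegral.integral_nonneg hR0 fun s _ => sq_nonneg _)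
      (by positivity), ← hconv _ (by fun_prop) fun s => sq_nonneg _]
  exact add_le_add (lintegral_mono_set Ioc_subset_Ioi_self) (ENNReal.ofReal_le_ofReal hRq)

/-- Otherwise $r^2q^6=(rq^2)^3/r>\delta^3/r$ for all large $r$, which is not integrable. This is
where the $L^6$ condition on the data removes the boundary term at infinity. -/
theorem exists_mul_sq_le_of_lintegral_lt_top {q : ℝ → ℝ}
    (h6 : ∫⁻ r in Ioi (0 : ℝ), ENNReal.ofReal (r ^ 2) * ‖q r‖ₑ ^ 6 < ⊤) :
    ∀ δ > (0 : ℝ), ∀ N : ℝ, ∃ R ≥ N, R * q R ^ 2 ≤ δ := by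
  intro δ hδ N
  by_contra! hcon
  refine not_integrableOn_Ioi_inv (a := max N 1) ?_
  have hpos : ∀ r ∈ Ioi (max N 1), 0 < r := fun r hr =>
    lt_trans one_pos ((le_max_right _ _).trans_lt hr)
  refine ⟨measurable_inv.aestronglyMeasurable, ?_⟩
  have hle : ∫⁻ r in Ioi (max N 1), ENNReal.ofReal (δ ^ 3) * ‖r⁻¹‖ₑ ≤
      ∫⁻ r in Ioi (0 : ℝ), ENNReal.ofReal (r ^ 2) * ‖q r‖ₑ ^ 6 := by
    refine (setLIntegral_mono' measurableSet_Ioi fun r hr => ?_).trans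
      (lintegral_mono_set fun r hr => hpos r hr)
    have hr0 := hpos r hr
    have h1 := hcon r ((le_max_left _ _).trans (le_of_lt hr))
    have h2 : δ ^ 3 ≤ (r * q r ^ 2) ^ 3 := by gcongr
    rw [Real.enorm_of_nonneg (by positivity : 0 ≤ r⁻¹), ← ENNReal.ofReal_mul (by positivity),
      Real.enorm_eq_ofReal_abs, ← ENNReal.ofReal_pow (abs_nonneg _),
      ← ENNReal.ofReal_mul (by positivity)]
    refine ENNReal.ofReal_le_ofReal ?_
    have h3 : |q r| ^ 6 = (q r ^ 2) ^ 3 := by rw [← sq_abs]; ring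
    rw [h3, ← div_eq_mul_inv, div_le_iff₀ hr0]
    calc δ ^ 3 ≤ (r * q r ^ 2) ^ 3 := h2
      _ = _ := by ring
  rw [lintegral_const_mul' _ _ ENNReal.ofReal_ne_top] at hle
  have h4 := hle.trans_lt h6
  by_contra h5
  rw [HasFiniteIntegral, not_lt, top_le_iff] at h5
  rw [h5, ENNReal.mul_top (by simpa using pow_pos hδ 3)] at h4
  exact lt_irrefl _ h4

variable {v₀ v₁ : E3 → ℝ}

/-- The `L²` norm of the wave profile is controlled by the energy of the data. -/
theorem lintegral_waveProfile_sub_one_sq_le (h₀ : ContDiff ℝ ∞ v₀) (h₁ : ContDiff ℝ ∞ v₁)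
    (hr₀ : IsRadial v₀) (hr₁ : IsRadial v₁) (h6 : ∫⁻ x, ‖v₀ x - 1‖ₑ ^ 6 < ⊤) :
    ∫⁻ s, ‖waveProfile v₀ v₁ s - 1‖ₑ ^ 2 ≤
      4 * ∫⁻ x, ENNReal.ofReal (v₁ x ^ 2 + ‖∇ v₀ x‖ ^ 2) := by
  set q : ℝ → ℝ := fun s => profile v₀ s - 1 with hqdef
  have hq : ContDiff ℝ ∞ q := (contDiff_profile h₀).sub contDiff_const
  have hdq : deriv q = deriv (profile v₀) := by ext s; simp [hqdef]
  have hc0 := (contDiff_profile h₀).continuous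
  have hc1 := (contDiff_profile h₁).continuous
  have hcd := (contDiff_deriv_of_infty (contDiff_profile h₀)).continuous
  have hqc := hq.continuous
  have hdecay := exists_mul_sq_le_of_lintegral_lt_top (q := q) (by
    refine (setLIntegral_sq_mul_le (F := fun r => ‖q r‖ₑ ^ 6) (by fun_prop)).trans_lt ?_
    simpa [hqdef, hr₀.profile_norm] using h6)
  have hA := setLIntegral_deriv_mul_sq_le hq hdecay
  rw [hdq] at hA
  -- From $(a+b)^2\le2a^2+2b^2$. The bound is even in $s$, so passing to the half line gives another
  -- factor 2, hence the constant 4.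
  have hpt : ∀ s, ‖waveProfile v₀ v₁ s - 1‖ₑ ^ 2 ≤
      2 * ENNReal.ofReal ((q s + s * deriv (profile v₀) s) ^ 2) +
        2 * ENNReal.ofReal ((s * profile v₁ s) ^ 2) := by
    intro s
    rw [show (2 : ℝ≥0∞) = ENNReal.ofReal 2 by simp, ← ENNReal.ofReal_mul (by norm_num),
      ← ENNReal.ofReal_mul (by norm_num), ← ENNReal.ofReal_add (by positivity) (by positivity),
      Real.enorm_eq_ofReal_abs, ← ENNReal.ofReal_pow (abs_nonneg _), sq_abs]
    refine ENNReal.ofReal_le_ofReal ?_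
    have : waveProfile v₀ v₁ s - 1 = (q s + s * deriv (profile v₀) s) + s * profile v₁ s := by
      simp only [waveProfile, hqdef]; ring
    rw [this]
    nlinarith [sq_nonneg ((q s + s * deriv (profile v₀) s) - s * profile v₁ s)]
  have hfin : (∫⁻ s in Ioi (0 : ℝ), ENNReal.ofReal ((s * deriv (profile v₀) s) ^ 2)) +
      ∫⁻ s in Ioi (0 : ℝ), ENNReal.ofReal ((s * profile v₁ s) ^ 2) ≤
      ∫⁻ x, ENNReal.ofReal (v₁ x ^ 2 + ‖∇ v₀ x‖ ^ 2) := by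
    rw [← lintegral_add_left (by fun_prop)]
    have hF : Measurable fun r => ENNReal.ofReal (profile v₁ r ^ 2 + deriv (profile v₀) r ^ 2) := by
      fun_prop
    calc _ = ∫⁻ r in Ioi (0 : ℝ), ENNReal.ofReal (r ^ 2) *
          ENNReal.ofReal (profile v₁ r ^ 2 + deriv (profile v₀) r ^ 2) := by
          congr 1; ext r
          rw [← ENNReal.ofReal_add (by positivity) (by positivity),
            ← ENNReal.ofReal_mul (by positivity)]
          congr 1; ring
      _ ≤ ∫⁻ x : E3, ENNReal.ofReal (profile v₁ ‖x‖ ^ 2 + deriv (profile v₀) ‖x‖ ^ 2) :=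
          setLIntegral_sq_mul_le hF
      _ ≤ _ := by
          refine lintegral_mono_ae ?_
          filter_upwards [compl_mem_ae_iff.2 (measure_singleton (0 : E3))] with x hx
          rw [hr₁.profile_norm, hr₀.deriv_profile_norm h₀ hx]
          refine ENNReal.ofReal_le_ofReal ?_
          refine add_le_add le_rfl ?_
          rw [← sq_abs (radialDeriv v₀ x)]
          gcongr
          exact abs_radialDeriv_le v₀ hx
  calc ∫⁻ s, ‖waveProfile v₀ v₁ s - 1‖ₑ ^ 2
      ≤ ∫⁻ s, (2 * ENNReal.ofReal ((q s + s * deriv (profile v₀) s) ^ 2) +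
        2 * ENNReal.ofReal ((s * profile v₁ s) ^ 2)) := lintegral_mono hpt
    _ = 2 * ∫⁻ s in Ioi (0 : ℝ), (2 * ENNReal.ofReal ((q s + s * deriv (profile v₀) s) ^ 2) +
        2 * ENNReal.ofReal ((s * profile v₁ s) ^ 2)) := by
        refine lintegral_even_eq fun s => ?_
        simp only [hqdef, hr₀.profile_neg, hr₁.profile_neg, deriv_neg_of_even hr₀.profile_neg,
          neg_mul_neg, neg_mul _ (profile _ _), neg_sq]
    _ = 4 * ((∫⁻ s in Ioi (0 : ℝ), ENNReal.ofReal ((q s + s * deriv (profile v₀) s) ^ 2)) +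
        ∫⁻ s in Ioi (0 : ℝ), ENNReal.ofReal ((s * profile v₁ s) ^ 2)) := by
        rw [lintegral_add_left (by fun_prop), lintegral_const_mul _ (by fun_prop),
          lintegral_const_mul _ (by fun_prop), ← mul_add, ← mul_assoc]
        norm_num
    _ ≤ 4 * ∫⁻ x, ENNReal.ofReal (v₁ x ^ 2 + ‖∇ v₀ x‖ ^ 2) := by
        gcongr
        exact (add_le_add_left hA _).trans hfin

/-- Spatial `L⁶` bound for half the mean of a square integrable profile. -/
theorem lintegral_half_radialMean_pow_six_lt_top {g : ℝ → ℝ} (hg : Continuous g)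
    (h2 : ∫⁻ s, ‖g s‖ₑ ^ 2 < ⊤) (t : ℝ) :
    ∫⁻ x : E3, ‖2⁻¹ * radialMean 0 g (t, x)‖ₑ ^ 6 < ⊤ := by
  set W : ℝ → ℝ≥0∞ := fun r => ‖2⁻¹ * weightedMean 0 g (t, r)‖ₑ with hW
  have hWm : Measurable W := by
    have : Continuous fun r => weightedMean 0 g (t, r) := by
      unfold weightedMean
      exact intervalIntegral.continuous_parametric_intervalIntegral_of_continuous' (by fun_prop) _ _
    fun_prop
  set K := ∫⁻ y, maximalFunction (fun s => ‖g s‖ₑ) y ^ 2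
  have hK : K < ⊤ := (lintegral_maximalFunction_sq_le (by fun_prop)).trans_lt
    (ENNReal.mul_lt_top (by simp) h2)
  have hle : ∀ r > 0, ∀ y ∈ Metric.ball t r, W r ≤ maximalFunction (fun s => ‖g s‖ₑ) y := by
    intro r hr y hy
    have h := enorm_half_radialMean_le (g := g) (p := (t, r • (EuclideanSpace.single 0 1 : E3)))
      (y := y) (by simpa [norm_smul, abs_of_pos hr] using hy)
    have hn : ‖r • (EuclideanSpace.single 0 1 : E3)‖ = r := by simp [norm_smul, abs_of_pos hr]
    rwa [radialMean, hn] at h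
  -- `W r` lies below the maximal function on a whole interval of length $2r$.
  have hdecay : ∀ r > 0, ENNReal.ofReal r * W r ^ 2 ≤ K := by
    intro r hr
    calc ENNReal.ofReal r * W r ^ 2 ≤ ENNReal.ofReal (2 * r) * W r ^ 2 := by gcongr; linarith
      _ = ∫⁻ y in Metric.ball t r, W r ^ 2 := by
          rw [setLIntegral_const, Real.volume_ball, mul_comm]
      _ ≤ ∫⁻ y in Metric.ball t r, maximalFunction (fun s => ‖g s‖ₑ) y ^ 2 :=
          setLIntegral_mono' Metric.isOpen_ball.measurableSet fun y hy => by
            gcongr; exact hle r hr y hy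
      _ ≤ K := setLIntegral_le_lintegral _ _
  -- The point $t+r/2$ lies in the ball of radius $r$ about $t$ and moves with $r$; the change of
  -- variables costs the factor 2.
  have hsq : ∫⁻ r in Ioi (0 : ℝ), W r ^ 2 ≤ 2 * K := by
    calc ∫⁻ r in Ioi (0 : ℝ), W r ^ 2
        ≤ ∫⁻ r in Ioi (0 : ℝ), maximalFunction (fun s => ‖g s‖ₑ) (t + 2⁻¹ * r) ^ 2 :=
          setLIntegral_mono' measurableSet_Ioi fun r hr => by
            have hr : 0 < r := hr
            gcongr
            refine hle r hr _ ?_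
            rw [Metric.mem_ball, Real.dist_eq, abs_of_pos (by linarith)]
            linarith
      _ ≤ ∫⁻ r, maximalFunction (fun s => ‖g s‖ₑ) (t + 2⁻¹ * r) ^ 2 :=
          setLIntegral_le_lintegral _ _
      _ = 2 * K := by
          have hm : Measurable fun y => maximalFunction (fun s => ‖g s‖ₑ) y ^ 2 :=
            (lowerSemicontinuous_maximalFunction _).measurable.pow_const 2
          have e1 : ∫⁻ r, maximalFunction (fun s => ‖g s‖ₑ) (t + 2⁻¹ * r) ^ 2 =
              ∫⁻ y, maximalFunction (fun s => ‖g s‖ₑ) (t + y) ^ 2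
                ∂(Measure.map (fun r : ℝ => 2⁻¹ * r) volume) := by
            exact (lintegral_map (hm.comp (measurable_const_add t)) (measurable_const_mul _)).symm
          rw [e1, Real.map_volume_mul_left (by norm_num), lintegral_smul_measure,
            lintegral_add_left_eq_self (fun y => maximalFunction (fun s => ‖g s‖ₑ) y ^ 2) t]
          norm_num
          rfl
  refine lintegral_comp_norm_lt_top (F := fun r => W r ^ 6) (by fun_prop) ?_
  calc ∫⁻ r in Ioi (0 : ℝ), ENNReal.ofReal (r ^ 2) * W r ^ 6
      ≤ ∫⁻ r in Ioi (0 : ℝ), K ^ 2 * W r ^ 2 := by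
        refine setLIntegral_mono' measurableSet_Ioi fun r hr => ?_
        rw [ENNReal.ofReal_pow (le_of_lt hr)]
        calc ENNReal.ofReal r ^ 2 * W r ^ 6 = (ENNReal.ofReal r * W r ^ 2) ^ 2 * W r ^ 2 := by ring
          _ ≤ K ^ 2 * W r ^ 2 := by gcongr; exact hdecay r hr
    _ = K ^ 2 * ∫⁻ r in Ioi (0 : ℝ), W r ^ 2 := lintegral_const_mul _ (by fun_prop)
    _ < ⊤ := ENNReal.mul_lt_top (ENNReal.pow_lt_top hK)
        (hsq.trans_lt (ENNReal.mul_lt_top (by simp) hK))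

end FiniteEnergy

/-! ### Norms as integrals. -/

section Norms

theorem sq_eLpNorm_two {F : Type*} [NormedAddCommGroup F] (f : E3 → F) :
    eLpNorm f 2 volume ^ 2 = ∫⁻ x, ‖f x‖ₑ ^ 2 := by
  have := eLpNorm_nnreal_pow_eq_lintegral (μ := (volume : Measure E3)) (f := f) (p := 2) two_ne_zero
  simpa using this

theorem continuous_gradient {f : E3 → ℝ} (hf : ContDiff ℝ ∞ f) : Continuous (∇ f) :=
  (LinearIsometryEquiv.continuous _).comp (hf.continuous_fderiv (by simp))

theorem energyNorm_eq {f : E3 → ℝ} (hf : ContDiff ℝ ∞ f) (g : E3 → ℝ) :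
    energyNorm f g = (∫⁻ x, ENNReal.ofReal (g x ^ 2 + ‖∇ f x‖ ^ 2)) ^ (1 / 2 : ℝ) := by
  have hc := continuous_gradient hf
  rw [energyNorm, hDotNorm, sq_eLpNorm_two, sq_eLpNorm_two, ← lintegral_add_left (by fun_prop)]
  congr 2; ext x
  rw [ENNReal.ofReal_add (by positivity) (by positivity), add_comm, ← ofReal_norm,
    ← ofReal_norm, ENNReal.ofReal_pow (norm_nonneg _), ← sq_abs (g x),
    ENNReal.ofReal_pow (abs_nonneg _), Real.norm_eq_abs]

theorem ENNReal.sq_rpow_half (a : ℝ≥0∞) : (a ^ 2) ^ (1 / 2 : ℝ) = a := by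
  rw [← ENNReal.rpow_natCast, ← ENNReal.rpow_mul]; norm_num

theorem hDotNorm_le_energyNorm (f g : E3 → ℝ) : hDotNorm f ≤ energyNorm f g := by
  calc hDotNorm f = (hDotNorm f ^ 2) ^ (1 / 2 : ℝ) := (ENNReal.sq_rpow_half _).symm
    _ ≤ _ := by unfold energyNorm; gcongr; exact le_self_add

theorem eLpNorm_le_energyNorm (f g : E3 → ℝ) : eLpNorm g 2 volume ≤ energyNorm f g := by
  calc eLpNorm g 2 volume = (eLpNorm g 2 volume ^ 2) ^ (1 / 2 : ℝ) := (ENNReal.sq_rpow_half _).symm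
    _ ≤ _ := by unfold energyNorm; gcongr; exact le_add_self

theorem energyNorm_lt_top {f g : E3 → ℝ} (hf : MemHDot f) (hg : MemLp g 2 volume) :
    energyNorm f g < ⊤ := by
  refine ENNReal.rpow_lt_top_of_nonneg (by norm_num) (ENNReal.add_lt_top.2 ⟨?_, ?_⟩).ne
  · exact ENNReal.pow_lt_top hf.2.2
  · exact ENNReal.pow_lt_top hg.2

theorem ENNReal.rpow_half_le_of_le {a b : ℝ≥0∞} {c : ℝ} (hc : 0 ≤ c)
    (h : a ≤ ENNReal.ofReal (c ^ 2) * b) :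
    a ^ (1 / 2 : ℝ) ≤ ENNReal.ofReal c * b ^ (1 / 2 : ℝ) := by
  calc a ^ (1 / 2 : ℝ) ≤ (ENNReal.ofReal (c ^ 2) * b) ^ (1 / 2 : ℝ) := by gcongr
    _ = _ := by
      rw [ENNReal.mul_rpow_of_nonneg _ _ (by norm_num), ENNReal.ofReal_pow hc,
        ENNReal.sq_rpow_half]

theorem memLp_six_iff {f : E3 → ℝ} (hf : Continuous f) :
    MemLp f 6 volume ↔ ∫⁻ x, ‖f x‖ₑ ^ 6 < ⊤ := by
  have h := eLpNorm_lt_top_iff_lintegral_rpow_enorm_lt_top (μ := (volume : Measure E3)) (f := f)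
    (p := 6) (by norm_num) (by norm_num)
  have e : (6 : ℝ≥0∞).toReal = ((6 : ℕ) : ℝ) := by norm_num
  rw [e] at h
  simp_rw [ENNReal.rpow_natCast] at h
  exact ⟨fun hm => h.1 hm.2, fun hm => ⟨hf.aestronglyMeasurable, h.2 hm⟩⟩

end Norms

/-! ### The linear data and the positivity of their wave profile. -/

section Data

variable {u₀ u₁ : E3 → ℝ} {ε : ℝ}

/-- A set of full measure is dense, so continuity turns the essential bound into a pointwise one. -/
theorem exists_abs_le_of_memLp_top (h₀ : Continuous u₀) (h : MemLp u₀ ⊤ volume) :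
    ∃ B, ∀ x, |u₀ x| ≤ B := by
  refine ⟨(eLpNorm u₀ ⊤ volume).toReal, fun x => ?_⟩
  have hae : ∀ᵐ x, |u₀ x| ≤ (eLpNorm u₀ ⊤ volume).toReal := by
    filter_upwards [ae_le_eLpNormEssSup (f := u₀) (μ := volume)] with x hx
    rw [← eLpNorm_exponent_top, ← ofReal_norm] at hx
    exact (ENNReal.ofReal_le_iff_le_toReal h.2.ne).1 hx
  have hd := Measure.dense_of_ae hae
  have hcl : IsClosed {x | |u₀ x| ≤ (eLpNorm u₀ ⊤ volume).toReal} :=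
    isClosed_le h₀.abs continuous_const
  have : x ∈ closure {x | |u₀ x| ≤ (eLpNorm u₀ ⊤ volume).toReal} := hd x
  rwa [hcl.closure_eq] at this

/-- Carries $L^6$ integrability from the bounded function $u_0$ to $e^{-u_0}-1$. -/
theorem abs_exp_sub_one_le_mul (y : ℝ) : |Real.exp y - 1| ≤ Real.exp |y| * |y| := by
  rcases le_total 0 y with hy | hy
  · rw [abs_of_nonneg hy, abs_of_nonneg (by linarith [Real.add_one_le_exp y])]
    have h1 := Real.add_one_le_exp (-y)
    have h2 : Real.exp y * Real.exp (-y) = 1 := by rw [← Real.exp_add]; simp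
    nlinarith [Real.exp_pos y]
  · rw [abs_of_nonpos hy, abs_of_nonpos (by linarith [Real.exp_le_one_iff.2 hy])]
    have h1 := Real.add_one_le_exp y
    have h2 := Real.one_le_exp (neg_nonneg.2 hy)
    nlinarith

/-- From $\log y\le y-1$, applied to $v$ above $1$ and to $v^{-1}\le m^{-1}$ below. This is the
source of the maximum in the final constant. -/
theorem abs_log_le_max_mul {m v : ℝ} (hm : 0 < m) (hv : m ≤ v) :
    |Real.log v| ≤ max 1 m⁻¹ * |v - 1| := by
  have hv0 : 0 < v := hm.trans_le hv
  rcases le_total 1 v with h | h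
  · rw [abs_of_nonneg (Real.log_nonneg h), abs_of_nonneg (by linarith)]
    calc Real.log v ≤ v - 1 := Real.log_le_sub_one_of_pos hv0
      _ ≤ _ := le_mul_of_one_le_left (by linarith) (le_max_left _ _)
  · rw [abs_of_nonpos (Real.log_nonpos hv0.le h), abs_of_nonpos (by linarith), ← Real.log_inv]
    calc Real.log v⁻¹ ≤ v⁻¹ - 1 := Real.log_le_sub_one_of_pos (inv_pos.2 hv0)
      _ = v⁻¹ * (-(v - 1)) := by field_simp; ring
      _ ≤ max 1 m⁻¹ * (-(v - 1)) := by
        refine mul_le_mul_of_nonneg_right ?_ (by linarith)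
        exact (inv_anti₀ hm hv).trans (le_max_right _ _)

theorem abs_le_max_mul_abs_exp_neg_sub_one {m a : ℝ} (hm : 0 < m) (ha : m ≤ Real.exp (-a)) :
    |a| ≤ max 1 m⁻¹ * |Real.exp (-a) - 1| := by
  have h := abs_log_le_max_mul hm ha
  rwa [Real.log_exp, abs_neg] at h

/-- The data `exp (-u₀)` of the linear wave. -/
noncomputable def linearData (u₀ : E3 → ℝ) (x : E3) : ℝ := Real.exp (-u₀ x)

/-- The initial velocity of the linear wave. -/
noncomputable def linearVelocity (u₀ u₁ : E3 → ℝ) (x : E3) : ℝ := Real.exp (-u₀ x) * -u₁ x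

theorem contDiff_linearData (h₀ : ContDiff ℝ ∞ u₀) : ContDiff ℝ ∞ (linearData u₀) := h₀.neg.exp

theorem contDiff_linearVelocity (h₀ : ContDiff ℝ ∞ u₀) (h₁ : ContDiff ℝ ∞ u₁) :
    ContDiff ℝ ∞ (linearVelocity u₀ u₁) := h₀.neg.exp.mul h₁.neg

theorem IsRadial.linearData (hr₀ : IsRadial u₀) : IsRadial (linearData u₀) := fun x y h => by
  simp [_root_.linearData, hr₀ x y h]

theorem IsRadial.linearVelocity (hr₀ : IsRadial u₀) (hr₁ : IsRadial u₁) :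
    IsRadial (linearVelocity u₀ u₁) := fun x y h => by
  simp [_root_.linearVelocity, hr₀ x y h, hr₁ x y h]

theorem norm_gradient_linearData (h₀ : ContDiff ℝ ∞ u₀) (x : E3) :
    ‖∇ (linearData u₀) x‖ = Real.exp (-u₀ x) * ‖∇ u₀ x‖ := by
  have h : HasFDerivAt (linearData u₀) _ x :=
    (h₀.differentiable (by simp) x).hasFDerivAt.fun_neg.exp
  rw [norm_gradient_eq, norm_gradient_eq, h.fderiv, norm_smul, norm_neg, Real.norm_eq_abs,
    abs_of_pos (Real.exp_pos _)]

theorem linear_energy_eq (h₀ : ContDiff ℝ ∞ u₀) (x : E3) :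
    linearVelocity u₀ u₁ x ^ 2 + ‖∇ (linearData u₀) x‖ ^ 2 =
      Real.exp (-u₀ x) ^ 2 * (u₁ x ^ 2 + ‖∇ u₀ x‖ ^ 2) := by
  rw [norm_gradient_linearData h₀, linearVelocity]; ring

theorem lintegral_linear_energy_le (h₀ : ContDiff ℝ ∞ u₀) (hb : BddBelow (range u₀)) :
    ∫⁻ x, ENNReal.ofReal (linearVelocity u₀ u₁ x ^ 2 + ‖∇ (linearData u₀) x‖ ^ 2) ≤
      ENNReal.ofReal (Real.exp (-⨅ x, u₀ x) ^ 2) *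
        ∫⁻ x, ENNReal.ofReal (u₁ x ^ 2 + ‖∇ u₀ x‖ ^ 2) := by
  rw [← lintegral_const_mul' _ _ ENNReal.ofReal_ne_top]
  refine lintegral_mono fun x => ?_
  rw [linear_energy_eq h₀, ← ENNReal.ofReal_mul (by positivity)]
  refine ENNReal.ofReal_le_ofReal ?_
  gcongr
  exact ciInf_le hb x

theorem lintegral_linearData_sub_one_lt_top (h₀ : ContDiff ℝ ∞ u₀) {B : ℝ}
    (hB : ∀ x, |u₀ x| ≤ B) (h6 : MemLp u₀ 6 volume) :
    ∫⁻ x, ‖linearData u₀ x - 1‖ₑ ^ 6 < ⊤ := by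
  refine (memLp_six_iff ((contDiff_linearData h₀).continuous.sub continuous_const)).1 ?_
  refine h6.of_le_mul (c := Real.exp B)
    ((contDiff_linearData h₀).continuous.sub continuous_const).aestronglyMeasurable
    (ae_of_all _ fun x => ?_)
  have h := abs_exp_sub_one_le_mul (-u₀ x)
  rw [abs_neg] at h
  refine h.trans ?_
  rw [Real.norm_eq_abs]
  gcongr
  exact hB x

theorem mul_deriv_eq_abs_mul_deriv_abs {p : ℝ → ℝ} (hp : ∀ s, p (-s) = p s) (s : ℝ) :
    s * deriv p s = |s| * deriv p |s| := by
  rcases le_total 0 s with hs | hs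
  · rw [abs_of_nonneg hs]
  · rw [abs_of_nonpos hs, deriv_neg_of_even hp]; ring

theorem waveProfile_linear_eq (h₀ : ContDiff ℝ ∞ u₀) (s : ℝ) :
    waveProfile (linearData u₀) (linearVelocity u₀ u₁) s =
      Real.exp (-profile u₀ s) * (1 - s * deriv (profile u₀) s - s * profile u₁ s) := by
  have hd : HasDerivAt (profile (linearData u₀))
      (Real.exp (-profile u₀ s) * -deriv (profile u₀) s) s :=
    ((contDiff_profile h₀).differentiable (by simp) s).hasDerivAt.fun_neg.exp
  rw [waveProfile, hd.deriv]
  simp only [profile, linearData, linearVelocity]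
  ring

/-- The sign condition on the data makes the wave profile uniformly positive. -/
theorem le_waveProfile_linear (h₀ : ContDiff ℝ ∞ u₀) (h₁ : ContDiff ℝ ∞ u₁)
    (hr₀ : IsRadial u₀) (hr₁ : IsRadial u₁) (hb : BddAbove (range u₀)) (hε : 0 < ε)
    (hcond : ∀ x : E3, x ≠ 0 → radialDeriv u₀ x + |u₁ x| ≤ (1 - ε) / ‖x‖) (s : ℝ) :
    ε * Real.exp (-⨆ x, u₀ x) ≤ waveProfile (linearData u₀) (linearVelocity u₀ u₁) s := by
  have hc := (contDiff_waveProfile (contDiff_linearData h₀)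
    (contDiff_linearVelocity h₀ h₁)).continuous
  have hcl : IsClosed {s | ε * Real.exp (-⨆ x, u₀ x) ≤
      waveProfile (linearData u₀) (linearVelocity u₀ u₁) s} := isClosed_le continuous_const hc
  -- The hypothesis is silent at the origin, so $s=0$ is reached by density.
  refine closure_minimal (s := {0}ᶜ) (fun s hs => ?_) hcl (dense_compl_singleton (0 : ℝ) s)
  have hs : s ≠ 0 := hs
  have hs' : 0 < |s| := abs_pos.2 hs
  rw [mem_ofPred_eq, waveProfile_linear_eq h₀]
  set x : E3 := |s| • EuclideanSpace.single 0 1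
  have hx : ‖x‖ = |s| := by simp [x, norm_smul]
  have hx0 : x ≠ 0 := norm_ne_zero_iff.1 (by rw [hx]; exact hs'.ne')
  have h2 : deriv (profile u₀) |s| = radialDeriv u₀ x := by
    rw [← hr₀.deriv_profile_norm h₀ hx0, hx]
  have h3 : profile u₁ s = u₁ x := hr₁.profile_eq hx.symm
  have h4 := hcond x hx0
  rw [hx, le_div_iff₀ hs'] at h4
  -- $s\,u_0'(s)$ is even, so negative $s$ reduces to the radius $|s|$; the term $s\,u_1$ changes
  -- sign with $s$, which is why $|u_1|$ appears in the hypothesis.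
  rw [mul_deriv_eq_abs_mul_deriv_abs hr₀.profile_neg, h2, h3]
  have h5 : s * u₁ x ≤ |s| * |u₁ x| := by rw [← abs_mul]; exact le_abs_self _
  have h6 : ε ≤ 1 - |s| * radialDeriv u₀ x - s * u₁ x := by nlinarith
  rw [mul_comm]
  gcongr
  exact le_ciSup hb _

end Data

/-! ### Existence, uniqueness and energy bound for the nonlinear equation. -/

section Solution

variable {u₀ u₁ : E3 → ℝ} {ε : ℝ}

/-- The linear wave with radial data `v₀, v₁`. -/
noncomputable def radialWave (v₀ v₁ : E3 → ℝ) (p : ℝ × E3) : ℝ :=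
  2⁻¹ * radialMean 0 (waveProfile v₀ v₁) p

theorem isLinearWave_radialWave {v₀ v₁ : E3 → ℝ} (h₀ : ContDiff ℝ ∞ v₀) (h₁ : ContDiff ℝ ∞ v₁) :
    IsLinearWave (radialWave v₀ v₁) :=
  isLinearWave_radialMean (contDiff_waveProfile h₀ h₁)

theorem dirDeriv_radialWave_zero {v₀ v₁ : E3 → ℝ} (h₀ : ContDiff ℝ ∞ v₀) (h₁ : ContDiff ℝ ∞ v₁)
    (hr₀ : IsRadial v₀) (hr₁ : IsRadial v₁) (x : E3) :
    dirDeriv timeDir (radialWave v₀ v₁) (0, x) = v₁ x := by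
  have hh := contDiff_waveProfile h₀ h₁
  rw [← half_radialMean_deriv_waveProfile h₀ h₁ hr₀ hr₁ x, ← dirDeriv_time_radialMean 0 hh]
  unfold radialWave
  rw [dirDeriv_mul contDiff_const (contDiff_radialMean 0 hh)]
  simp [dirDeriv]

theorem isNullFormSolution_neg_log_radialWave (h₀ : ContDiff ℝ ∞ u₀) (h₁ : ContDiff ℝ ∞ u₁)
    (hr₀ : IsRadial u₀) (hr₁ : IsRadial u₁)
    (hpos : ∀ p, 0 < radialWave (linearData u₀) (linearVelocity u₀ u₁) p) :
    IsNullFormSolution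
      (fun t x => -Real.log (radialWave (linearData u₀) (linearVelocity u₀ u₁) (t, x))) u₀ u₁ := by
  have k₀ := contDiff_linearData h₀
  have k₁ := contDiff_linearVelocity h₀ h₁
  have hV := isLinearWave_radialWave k₀ k₁
  set V := radialWave (linearData u₀) (linearVelocity u₀ u₁) with hVdef
  have hsm : ContDiff ℝ ∞ fun p : ℝ × E3 => -Real.log (V (p.1, p.2)) :=
    (hV.smooth.log fun p => (hpos p).ne').neg
  have hV0 : ∀ x, V (0, x) = Real.exp (-u₀ x) :=
    half_radialMean_waveProfile k₀ k₁ hr₀.linearData (hr₀.linearVelocity hr₁)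
  refine ⟨hsm, fun t x => ?_, fun x => ?_, fun x => ?_⟩
  · rw [timeDeriv_timeDeriv_eq hsm,
      laplacian_slice_eq (u := fun t x => -Real.log (V (t, x))) hsm,
      norm_gradient_slice_sq (u := fun t x => -Real.log (V (t, x))) hsm, timeDeriv_eq hsm]
    exact neg_log_equation hV hpos (t, x)
  · simp [hV0]
  · rw [timeDeriv_eq hsm]
    simp only [Prod.mk.eta]
    rw [dirDeriv_neg_log hV.smooth hpos]
    have hV1 : dirDeriv timeDir V (0, x) = linearVelocity u₀ u₁ x :=
      dirDeriv_radialWave_zero k₀ k₁ hr₀.linearData (hr₀.linearVelocity hr₁) x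
    simp only [hV0, hV1]
    rw [linearVelocity]
    have := Real.exp_ne_zero (-u₀ x)
    field_simp

variable {u : ℝ → E3 → ℝ}

theorem IsNullFormSolution.isLinearWave_exp_neg (hu : IsNullFormSolution u u₀ u₁) :
    IsLinearWave fun p => Real.exp (-u p.1 p.2) := by
  refine _root_.isLinearWave_exp_neg hu.smooth fun p => ?_
  have h := hu.equation p.1 p.2
  rw [timeDeriv_timeDeriv_eq hu.smooth, laplacian_slice_eq hu.smooth,
    norm_gradient_slice_sq hu.smooth, timeDeriv_eq hu.smooth] at h
  exact h

/-- Smooth solutions are given by the explicit linear wave. -/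
theorem IsNullFormSolution.exp_neg_eq (hu : IsNullFormSolution u u₀ u₁)
    (h₀ : ContDiff ℝ ∞ u₀) (h₁ : ContDiff ℝ ∞ u₁) (hr₀ : IsRadial u₀) (hr₁ : IsRadial u₁)
    (t : ℝ) (x : E3) :
    Real.exp (-u t x) = radialWave (linearData u₀) (linearVelocity u₀ u₁) (t, x) := by
  have k₀ := contDiff_linearData h₀
  have k₁ := contDiff_linearVelocity h₀ h₁
  have hV := isLinearWave_radialWave k₀ k₁
  have hE := hu.isLinearWave_exp_neg
  have hV0 : ∀ x, radialWave (linearData u₀) (linearVelocity u₀ u₁) (0, x) = Real.exp (-u₀ x) :=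
    half_radialMean_waveProfile k₀ k₁ hr₀.linearData (hr₀.linearVelocity hr₁)
  refine sub_eq_zero.1 ((hE.sub hV).eq_zero (fun x => ?_) (fun x => ?_) (t, x))
  · simp [hV0, hu.init]
  · rw [dirDeriv_sub hE.smooth hV.smooth, dirDeriv_exp_neg hu.smooth,
      dirDeriv_radialWave_zero k₀ k₁ hr₀.linearData (hr₀.linearVelocity hr₁), linearVelocity]
    have h := hu.init_deriv x
    rw [timeDeriv_eq hu.smooth] at h
    simp only [hu.init, h, sub_self]

theorem energyDensity_exp_neg {U : ℝ × E3 → ℝ} (hU : ContDiff ℝ ∞ U) (p : ℝ × E3) :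
    energyDensity (fun p => Real.exp (-U p)) p = Real.exp (-U p) ^ 2 * energyDensity U p := by
  simp only [energyDensity, dirDeriv_exp_neg hU, mul_pow, neg_sq, ← Finset.mul_sum]
  ring

/-- The densities of $e^{-u}$ and $u$ differ by the factor $e^{-2u}$, bounded below by $m^2$ at time
$t$ and above by $e^{-2\inf u_0}$ at time $0$; in between, the linear energy inequality applies. -/
theorem IsNullFormSolution.lintegral_energy_le (hu : IsNullFormSolution u u₀ u₁)
    (h₀ : ContDiff ℝ ∞ u₀) (hb : BddBelow (range u₀)) {m : ℝ} (hm : 0 < m)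
    (hlow : ∀ t x, m ≤ Real.exp (-u t x)) (t : ℝ) :
    ∫⁻ x, ENNReal.ofReal (timeDeriv u t x ^ 2 + ‖∇ (u t) x‖ ^ 2) ≤
      ENNReal.ofReal ((m⁻¹ * Real.exp (-⨅ x, u₀ x)) ^ 2) *
        ∫⁻ x, ENNReal.ofReal (u₁ x ^ 2 + ‖∇ u₀ x‖ ^ 2) := by
  have hE := hu.isLinearWave_exp_neg
  have hu0 : u 0 = u₀ := funext hu.init
  calc ∫⁻ x, ENNReal.ofReal (timeDeriv u t x ^ 2 + ‖∇ (u t) x‖ ^ 2)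
      ≤ ∫⁻ x, ENNReal.ofReal ((m⁻¹) ^ 2) *
          ENNReal.ofReal (energyDensity (fun p => Real.exp (-u p.1 p.2)) (t, x)) := by
        refine lintegral_mono fun x => ?_
        rw [← ENNReal.ofReal_mul (by positivity), energyDensity_exp_neg hu.smooth,
          energyDensity_eq hu.smooth, ← mul_assoc, ← mul_pow]
        refine ENNReal.ofReal_le_ofReal (le_mul_of_one_le_left (by positivity) ?_)
        refine one_le_pow₀ ?_
        rw [inv_mul_eq_div, one_le_div hm]
        exact hlow t x
    _ = ENNReal.ofReal ((m⁻¹) ^ 2) *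
          ∫⁻ x, ENNReal.ofReal (energyDensity (fun p => Real.exp (-u p.1 p.2)) (t, x)) :=
        lintegral_const_mul' _ _ ENNReal.ofReal_ne_top
    _ ≤ ENNReal.ofReal ((m⁻¹) ^ 2) *
          ∫⁻ x, ENNReal.ofReal (energyDensity (fun p => Real.exp (-u p.1 p.2)) (0, x)) := by
        exact mul_le_mul_right (hE.energy_le t) _
    _ = ENNReal.ofReal ((m⁻¹) ^ 2) *
          ∫⁻ x, ENNReal.ofReal (linearVelocity u₀ u₁ x ^ 2 + ‖∇ (linearData u₀) x‖ ^ 2) := by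
        congr 2; ext x
        rw [energyDensity_exp_neg hu.smooth, energyDensity_eq hu.smooth, linear_energy_eq h₀,
          hu.init_deriv, hu0]
    _ ≤ _ := by
        rw [mul_pow, ENNReal.ofReal_mul (by positivity), mul_assoc]
        gcongr
        exact lintegral_linear_energy_le h₀ hb

end Solution

/-! ### Assembly of the main theorem. -/

theorem mainTheorem9 :
    ∃ C : ℝ, 0 < C ∧
      ∀ (u₀ u₁ : E3 → ℝ) (ε : ℝ),
        ContDiff ℝ ∞ u₀ → ContDiff ℝ ∞ u₁ → IsRadial u₀ → IsRadial u₁ →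
        MemLp u₀ ⊤ volume → MemHDot u₀ → MemLp u₁ 2 volume →
        0 < ε →
        (∀ x : E3, x ≠ 0 → radialDeriv u₀ x + |u₁ x| ≤ (1 - ε) / ‖x‖) →
        (∃ u : ℝ → E3 → ℝ, IsNullFormSolution u u₀ u₁) ∧
        ∀ u : ℝ → E3 → ℝ, IsNullFormSolution u u₀ u₁ →
          ((∀ t : ℝ, MemHDot (u t)) ∧ (⨆ t : ℝ, hDotNorm (u t)) < ⊤) ∧
          normL2Linfty u < ⊤ ∧
          ((∀ t : ℝ, MemLp (timeDeriv u t) 2 volume) ∧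
            (⨆ t : ℝ, eLpNorm (timeDeriv u t) 2 volume) < ⊤) ∧
          (⨆ t : ℝ, energyNorm (u t) (timeDeriv u t)) ≤
            ENNReal.ofReal (Real.exp ((⨆ x, u₀ x) - (⨅ x, u₀ x)) * ε⁻¹) *
              energyNorm u₀ u₁ ∧
          normL2Linfty u ≤
            ENNReal.ofReal
              (C * max 1 (Real.exp (⨆ x, u₀ x) * ε⁻¹) * Real.exp (-(⨅ x, u₀ x))) *
                energyNorm u₀ u₁ := by
  -- The squared estimate has constant $160=40\cdot4$, from the maximal theorem and the profile
  -- bound, and $160\le13^2$.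
  refine ⟨13, by norm_num, fun u₀ u₁ ε h₀ h₁ hr₀ hr₁ htop hdot hL2 hε hcond => ?_⟩
  obtain ⟨B, hB⟩ := exists_abs_le_of_memLp_top h₀.continuous htop
  have hba : BddAbove (range u₀) := ⟨B, by rintro _ ⟨x, rfl⟩; exact (abs_le.1 (hB x)).2⟩
  have hbb : BddBelow (range u₀) := ⟨-B, by rintro _ ⟨x, rfl⟩; exact (abs_le.1 (hB x)).1⟩
  have k₀ := contDiff_linearData h₀
  have k₁ := contDiff_linearVelocity h₀ h₁
  set h := waveProfile (linearData u₀) (linearVelocity u₀ u₁) with hh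
  have hc : Continuous h := (contDiff_waveProfile k₀ k₁).continuous
  set m := ε * Real.exp (-⨆ x, u₀ x) with hmdef
  have hm : 0 < m := by positivity
  have hminv : m⁻¹ = Real.exp (⨆ x, u₀ x) * ε⁻¹ := by
    rw [hmdef, mul_inv, Real.exp_neg, inv_inv, mul_comm]
  have hV : ∀ p, m ≤ radialWave (linearData u₀) (linearVelocity u₀ u₁) p :=
    le_half_radialMean hc (le_waveProfile_linear h₀ h₁ hr₀ hr₁ hba hε hcond)
  refine ⟨⟨_, isNullFormSolution_neg_log_radialWave h₀ h₁ hr₀ hr₁ fun p => hm.trans_le (hV p)⟩,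
    fun u hu => ?_⟩
  have hexp := hu.exp_neg_eq h₀ h₁ hr₀ hr₁
  have hlow : ∀ t x, m ≤ Real.exp (-u t x) := fun t x => (hV (t, x)).trans_eq (hexp t x).symm
  have hslice : ∀ t, ContDiff ℝ ∞ (u t) := fun t =>
    hu.smooth.comp (contDiff_const.prodMk contDiff_id)
  have hE0 : energyNorm u₀ u₁ < ⊤ := energyNorm_lt_top hdot hL2
  have henergy : ∀ t, energyNorm (u t) (timeDeriv u t) ≤
      ENNReal.ofReal (Real.exp ((⨆ x, u₀ x) - (⨅ x, u₀ x)) * ε⁻¹) * energyNorm u₀ u₁ := by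
    intro t
    rw [energyNorm_eq (hslice t), energyNorm_eq h₀]
    have e : m⁻¹ * Real.exp (-⨅ x, u₀ x) = Real.exp ((⨆ x, u₀ x) - (⨅ x, u₀ x)) * ε⁻¹ := by
      rw [hminv, sub_eq_add_neg, Real.exp_add]; ring
    rw [← e]
    exact ENNReal.rpow_half_le_of_le (by positivity) (hu.lintegral_energy_le h₀ hbb hm hlow t)
  have hEtop : ENNReal.ofReal (Real.exp ((⨆ x, u₀ x) - (⨅ x, u₀ x)) * ε⁻¹) * energyNorm u₀ u₁ < ⊤ :=
    ENNReal.mul_lt_top ENNReal.ofReal_lt_top hE0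
  have hg : ∀ p, Real.exp (-u p.1 p.2) - 1 = 2⁻¹ * radialMean 0 (fun s => h s - 1) p := fun p => by
    rw [hexp, ← half_radialMean_sub_one hc]; rfl
  have hgL2 := lintegral_waveProfile_sub_one_sq_le k₀ k₁ hr₀.linearData (hr₀.linearVelocity hr₁)
    (lintegral_linearData_sub_one_lt_top h₀ hB hdot.1)
  have hgE : ∫⁻ s, ‖h s - 1‖ₑ ^ 2 ≤ ENNReal.ofReal (4 * Real.exp (-⨅ x, u₀ x) ^ 2) *
      ∫⁻ x, ENNReal.ofReal (u₁ x ^ 2 + ‖∇ u₀ x‖ ^ 2) := by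
    refine hgL2.trans ?_
    rw [ENNReal.ofReal_mul (by norm_num), mul_assoc, show ENNReal.ofReal 4 = 4 by simp]
    gcongr
    exact lintegral_linear_energy_le h₀ hbb
  have hEint : ∫⁻ x, ENNReal.ofReal (u₁ x ^ 2 + ‖∇ u₀ x‖ ^ 2) < ⊤ := by
    rw [energyNorm_eq h₀] at hE0
    exact (ENNReal.rpow_lt_top_iff_of_pos (by norm_num)).1 hE0
  have hgfin : ∫⁻ s, ‖h s - 1‖ₑ ^ 2 < ⊤ :=
    hgE.trans_lt (ENNReal.mul_lt_top ENNReal.ofReal_lt_top hEint)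
  have hbound : ∀ t x, ‖u t x‖ ≤ max 1 m⁻¹ * ‖2⁻¹ * radialMean 0 (fun s => h s - 1) (t, x)‖ := by
    intro t x
    rw [← hg (t, x)]
    exact abs_le_max_mul_abs_exp_neg_sub_one hm (hlow t x)
  have hL6 : ∀ t, MemLp (u t) 6 volume := by
    intro t
    have hcm : Continuous fun x : E3 => 2⁻¹ * radialMean 0 (fun s => h s - 1) (t, x) :=
      continuous_const.mul ((contDiff_radialMean 0 ((contDiff_waveProfile k₀ k₁).sub
        contDiff_const)).continuous.comp (by fun_prop))
    exact ((memLp_six_iff hcm).2 (lintegral_half_radialMean_pow_six_lt_top (by fun_prop) hgfin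
      t)).of_le_mul (hslice t).continuous.aestronglyMeasurable (ae_of_all _ (hbound t))
  have hstr : normL2Linfty u ≤ ENNReal.ofReal
      (13 * max 1 (Real.exp (⨆ x, u₀ x) * ε⁻¹) * Real.exp (-(⨅ x, u₀ x))) * energyNorm u₀ u₁ := by
    rw [energyNorm_eq h₀, normL2Linfty]
    refine ENNReal.rpow_half_le_of_le (by positivity) ?_
    have hpt : ∀ t, eLpNorm (u t) ⊤ volume ≤ ENNReal.ofReal (max 1 m⁻¹) *
        maximalFunction (fun s => ‖h s - 1‖ₑ) t := by
      intro t
      rw [eLpNorm_exponent_top]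
      refine essSup_le_of_ae_le _ ?_
      -- At $x=0$ the ball of radius $\|x\|$ is empty and gives no average; this null set does not
      -- affect the essential supremum.
      filter_upwards [compl_mem_ae_iff.2 (measure_singleton (0 : E3))] with x hx
      have hx0 : 0 < ‖x‖ := norm_pos_iff.2 hx
      calc ‖u t x‖ₑ ≤ ENNReal.ofReal (max 1 m⁻¹) *
            ‖2⁻¹ * radialMean 0 (fun s => h s - 1) (t, x)‖ₑ := by
            rw [← ofReal_norm, ← ofReal_norm, ← ENNReal.ofReal_mul (by positivity)]
            exact ENNReal.ofReal_le_ofReal (hbound t x)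
        _ ≤ _ := by
            gcongr
            exact enorm_half_radialMean_le (p := (t, x)) (Metric.mem_ball_self hx0)
    calc ∫⁻ t, eLpNorm (u t) ⊤ volume ^ 2
        ≤ ∫⁻ t, ENNReal.ofReal (max 1 m⁻¹ ^ 2) * maximalFunction (fun s => ‖h s - 1‖ₑ) t ^ 2 := by
          refine lintegral_mono fun t => ?_
          rw [ENNReal.ofReal_pow (by positivity), ← mul_pow]
          gcongr
          exact hpt t
      _ = ENNReal.ofReal (max 1 m⁻¹ ^ 2) * ∫⁻ t, maximalFunction (fun s => ‖h s - 1‖ₑ) t ^ 2 :=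
          lintegral_const_mul' _ _ ENNReal.ofReal_ne_top
      _ ≤ ENNReal.ofReal (max 1 m⁻¹ ^ 2) * (40 * (ENNReal.ofReal (4 * Real.exp (-⨅ x, u₀ x) ^ 2) *
            ∫⁻ x, ENNReal.ofReal (u₁ x ^ 2 + ‖∇ u₀ x‖ ^ 2))) := by
          gcongr
          exact (lintegral_maximalFunction_sq_le (by fun_prop)).trans (by gcongr)
      _ = ENNReal.ofReal (160 * (max 1 m⁻¹ * Real.exp (-⨅ x, u₀ x)) ^ 2) *
            ∫⁻ x, ENNReal.ofReal (u₁ x ^ 2 + ‖∇ u₀ x‖ ^ 2) := by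
          rw [show (40 : ℝ≥0∞) = ENNReal.ofReal 40 by simp, ← mul_assoc, ← mul_assoc,
            ← ENNReal.ofReal_mul (by positivity), ← ENNReal.ofReal_mul (by positivity)]
          congr 2; ring
      _ ≤ _ := by
          rw [← hminv]
          gcongr
          nlinarith [sq_nonneg (max 1 m⁻¹ * Real.exp (-⨅ x, u₀ x))]
  refine ⟨⟨fun t => ⟨hL6 t, (continuous_gradient (hslice t)).aestronglyMeasurable,
      ((hDotNorm_le_energyNorm _ _).trans (henergy t)).trans_lt hEtop⟩,
    (iSup_le fun t => (hDotNorm_le_energyNorm _ _).trans (henergy t)).trans_lt hEtop⟩,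
    hstr.trans_lt (ENNReal.mul_lt_top ENNReal.ofReal_lt_top hE0), ⟨fun t => ⟨?_,
      ((eLpNorm_le_energyNorm (u t) _).trans (henergy t)).trans_lt hEtop⟩,
    (iSup_le fun t => (eLpNorm_le_energyNorm (u t) _).trans (henergy t)).trans_lt hEtop⟩,
    iSup_le henergy, hstr⟩
  rw [timeDeriv_eq hu.smooth]
  exact ((hu.smooth.dirDeriv timeDir).continuous.comp
    (by fun_prop : Continuous fun x : E3 => (t, x))).aestronglyMeasurable
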